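/- There is an absolute constant $C>0$ with the following property. For $F\in L^2(\mathbb R^2\times\mathbb R^2)$ let $\widehat F(\zeta)=\int e^{-i\langle x,\zeta\rangle}F(x)\,dx$ be its Fourier transform on $\mathbb R^4$ (extended to $L^2$ by continuity). For a symbol $b:(0,\infty)\times\mathbb R^2\times\mathbb R^2\to\mathbb C$ and a fixed choice of the sign $\pm$ put $$S[F,b](\xi,t)=\int_{\mathbb R^2} e^{\pm it(|\xi-\eta|+|\eta|)}\,b(t,\xi,\eta)\,\widehat F(\xi-\eta,\eta)\,d\eta .$$ For real $j$ let $\Theta_j=\{\omega\in\mathbb R^2:\ 0<\omega_1<2^{-10}\omega_2,\ 2^{j-1}\le|\omega|\le 2^{j+1}\}$, and call $b$ $(j,m)$-adapted if $b$ is smooth and $b(t,\xi,\eta)=0$ unless $\eta,\ \xi-\eta\in\Theta_j$ and the angle $\measuredangle(\xi,\eta)\in[0,\pi]$ is at most $2^{-m+5}$. Let $j,m,\ell,B$ be real numbers with $0\le m\le j/2$ and $\ell\ge 0$, let $b$ be $(j,m)$-adapted, and suppose that $$|\partial_\eta^\alpha b(t,\xi,\eta)|\le B\,2^{-(j-m)|\alpha|}\qquad\text{for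 all } t\in[1,2],\ \xi,\eta\in\mathbb R^2 \text{ and all multiindices } |\alpha|\le 9 .$$ Let $F\in L^2(\mathbb R^2\times\mathbb R^2)$ be supported in $\{(y,z):\ |y-z|\ge 2^{-m+\ell+20}\}$. Then for every finite set $\mathcal E\subset[1,2]$ and either sign, the integral defining $S[F,b](\xi,t)$ converges absolutely for every $t\in\mathcal E$ and almost every $\xi$, $S[F,b]\in L^2(\mathbb R^2\times\mathcal E)$, and $$\|S[F,b]\|_{L^2(\mathbb R^2\times\mathcal E)}\le C\,B\,2^{\frac32 m-\ell}\,(\#\mathcal E)^{1/2}\,\|F\|_{L^2(\mathbb R^4)},$$ where $\mathbb R^2\times\mathcal E$ carries the product of Lebesgue measure and counting measure. -/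

import Mathlib

open MeasureTheory Set
open scoped ContDiff FourierTransform ENNReal

noncomputable section

namespace OffDiag

/-- The Euclidean plane `ℝ²`. -/
abbrev Plane : Type := EuclideanSpace ℝ (Fin 2)

/-- `ℝ⁴ = ℝ² × ℝ²` with its Euclidean structure and Lebesgue measure. -/
abbrev Plane2 : Type := WithLp 2 (Plane × Plane)

/-- The annular sector `Θ_j = {w : 0 < w₁ < 2^{-10} w₂, 2^{j-1} ≤ |w| ≤ 2^{j+1}}`. -/
def Theta (j : ℝ) : Set Plane :=
  {w | 0 < w 0 ∧ w 0 < (2 : ℝ) ^ (-10 : ℝ) * w 1 ∧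
    (2 : ℝ) ^ (j - 1) ≤ ‖w‖ ∧ ‖w‖ ≤ (2 : ℝ) ^ (j + 1)}

/-- A symbol `b : (0,∞) × ℝ² × ℝ² → ℂ` (only its values at `t > 0` are used) is
`(j,m)`-adapted if it is smooth and `b(t,ξ,η) = 0` unless `η, ξ - η ∈ Θ_j` and the angle between
`ξ` and `η` is at most `2^{-m+5}`. -/
structure IsAdapted (j m : ℝ) (b : ℝ → Plane → Plane → ℂ) : Prop where
  smooth : ContDiffOn ℝ ∞ (fun p : ℝ × Plane × Plane => b p.1 p.2.1 p.2.2) (Ioi 0 ×ˢ univ)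
  eq_zero_unless : ∀ t : ℝ, 0 < t → ∀ ξ η : Plane,
    ¬ (η ∈ Theta j ∧ ξ - η ∈ Theta j ∧
        InnerProductGeometry.angle ξ η ≤ (2 : ℝ) ^ (-m + 5)) →
      b t ξ η = 0

/-- The symbol bounds `|∂_η^α b(t,ξ,η)| ≤ B 2^{-(j-m)|α|}` for `|α| ≤ 9` and `t ∈ [1,2]`.
The partial derivative of order `k` in the coordinate directions `v 0, …, v (k-1)` is the value of
the `k`-th derivative on the corresponding standard basis vectors. -/
def SymbolBound (j m B : ℝ) (b : ℝ → Plane → Plane → ℂ) : Prop :=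
  ∀ t ∈ Icc (1 : ℝ) 2, ∀ ξ η : Plane, ∀ k : ℕ, k ≤ 9 → ∀ v : Fin k → Fin 2,
    ‖iteratedFDeriv ℝ k (fun η' : Plane => b t ξ η') η
        (fun i => EuclideanSpace.single (v i) (1 : ℝ))‖
      ≤ B * (2 : ℝ) ^ (-(j - m) * k)

/-- The Fourier transform `F̂(ζ) = ∫ e^{-i⟨x,ζ⟩} F(x) dx` on `L²(ℝ⁴)` (extended from Schwartz
functions by continuity). Mathlib's `𝓕` has the kernel `e^{-2πi⟨x,ζ⟩}`, so
`F̂(ζ) = (𝓕 F)(ζ / 2π)`. -/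
def hat (F : Lp ℂ 2 (volume : Measure Plane2)) (ζ : Plane2) : ℂ :=
  (𝓕 F : Lp ℂ 2 (volume : Measure Plane2)) ((2 * Real.pi)⁻¹ • ζ)

/-- The integrand `e^{± i t (|ξ-η| + |η|)} b(t,ξ,η) F̂(ξ-η,η)`; the sign is `σ = ±1`. -/
def integrandS (σ : ℝ) (F : Lp ℂ 2 (volume : Measure Plane2)) (b : ℝ → Plane → Plane → ℂ)
    (ξ : Plane) (t : ℝ) (η : Plane) : ℂ :=
  Complex.exp (Complex.I * ((σ * t * (‖ξ - η‖ + ‖η‖) : ℝ) : ℂ)) * b t ξ η *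
    hat F (WithLp.toLp 2 (ξ - η, η))

/-- `S[F,b](ξ,t) = ∫ e^{± i t (|ξ-η| + |η|)} b(t,ξ,η) F̂(ξ-η,η) dη`. -/
def S (σ : ℝ) (F : Lp ℂ 2 (volume : Measure Plane2)) (b : ℝ → Plane → Plane → ℂ)
    (ξ : Plane) (t : ℝ) : ℂ :=
  ∫ η : Plane, integrandS σ F b ξ t η

/-- Lebesgue measure on `ℝ²` times counting measure on the finite set `𝓔`. -/
def planeTimes (𝓔 : Finset ℝ) : Measure (Plane × 𝓔) :=
  (volume : Measure Plane).prod Measure.count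

end OffDiag

end

noncomputable section

namespace OffDiag

open Filter
open scoped SchwartzMap LineDeriv NNReal Topology

/-! Fix `t` and `ξ`, and write `S[F,b](ξ,t) = ∫ a(η) H(η) dη` with the oscillating symbol `a = osc ·
b` and `H(η) = F̂(ξ-η,η)`. Translating `η` modulates `F` in the variable `z - y`, so the support
condition on `F` says that `H` has no frequencies below `R = 2^{-m+ℓ+20}`. The low frequency part of
`a` therefore integrates to zero against `H` (`ae_integral_average_eq_zero`), and Cauchy–Schwarz
leaves `‖highFreq R a‖₂ ‖H‖₂` (`ae_enorm_integral_le`).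

The high frequency part of `a` is small because `a` oscillates slowly compared with `R`. Both `η`
and `ξ-η` are nearly parallel to `ξ`, so the phase gradient is `O(2^{-m})` (`norm_phaseGrad_le`),
below `R/8`. Write `∂a = iψa + r`, where `ψ` extends the phase gradient and `r` carries the
derivative of `b`. In `energy_estimate`, Bernstein's inequality bounds `‖highFreq R a‖₂` by `R⁻¹`
times the norm of its gradient; the term with `ψ` is absorbed, and what remains is `‖r‖₂` and the
commutator of the projection with `ψ`. The latter costs `Lip(ψ)/R = O(2^{-j}/R)` times `‖a‖₂`.

The support of `a` has area `O(2^{2j-m})` (`volume_symbolRegion_le`), so `‖a‖₂ ≲ B 2^{j-m/2}` and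
`‖r‖₂ ≲ B 2^{m/2}`. Division by `R` gives `B 2^{3m/2-ℓ}` (`eLpNorm_highFreq_oscS_le`). Plancherel in
`(ξ,η)` handles the integral over `ξ`, and summing over `t` gives the factor `(#𝓔)^{1/2}`. -/

/-! ### Frequency projections on the plane -/

/-- A fixed bump function, equal to `1` on `|w| ≤ (4π)⁻¹` and supported in `|w| < (2π)⁻¹`. -/
def bump : ContDiffBump (0 : Plane) where
  rIn := (4 * Real.pi)⁻¹
  rOut := (2 * Real.pi)⁻¹
  rIn_pos := by positivity
  rIn_lt_rOut := by
    apply inv_strictAnti₀ <;> nlinarith [Real.pi_pos]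

lemma hasCompactSupport_bump : HasCompactSupport (fun w : Plane => (bump w : ℂ)) :=
  bump.hasCompactSupport.comp_left (g := fun x : ℝ => (x : ℂ)) (by simp)

lemma contDiff_bump : ContDiff ℝ ∞ (fun w : Plane => (bump w : ℂ)) :=
  Complex.ofRealCLM.contDiff.comp bump.contDiff

/-- The bump as a Schwartz function. -/
def bumpS : 𝓢(Plane, ℂ) := hasCompactSupport_bump.toSchwartzMap contDiff_bump

/-- The convolution kernel whose Fourier transform is the bump. -/
def kernel : 𝓢(Plane, ℂ) := 𝓕⁻ bumpS

lemma fourier_kernel (w : Plane) : 𝓕 (kernel : Plane → ℂ) w = (bump w : ℂ) := by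
  rw [← SchwartzMap.fourier_coe, kernel, FourierTransform.fourier_fourierInv_eq]
  rfl

/-- The dilated low frequency cutoff. -/
def cutoff (R : ℝ) (w : Plane) : ℂ := (bump (R⁻¹ • w) : ℂ)

lemma cutoff_hasTemperateGrowth (R : ℝ) : (cutoff R).HasTemperateGrowth := by
  have h : (fun w : Plane => bumpS w).HasTemperateGrowth := bumpS.hasTemperateGrowth
  have h2 : (fun w : Plane => R⁻¹ • w).HasTemperateGrowth := by fun_prop
  exact h.comp h2

/-- The low frequency projection. -/
def lowFreq (R : ℝ) : 𝓢(Plane, ℂ) →L[ℂ] 𝓢(Plane, ℂ) :=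
  SchwartzMap.fourierMultiplierCLM ℂ (cutoff R)

lemma fourier_lowFreq (R : ℝ) (f : 𝓢(Plane, ℂ)) (w : Plane) :
    𝓕 (lowFreq R f) w = cutoff R w * 𝓕 f w := by
  rw [lowFreq, SchwartzMap.fourierMultiplierCLM_apply, FourierTransform.fourier_fourierInv_eq,
    SchwartzMap.smulLeftCLM_apply_apply (cutoff_hasTemperateGrowth R), smul_eq_mul]

/-- Both operators are Fourier multipliers, so they commute. -/
lemma lineDeriv_lowFreq (R : ℝ) (f : 𝓢(Plane, ℂ)) (m : Plane) :
    ∂_{m} (lowFreq R f) = lowFreq R (∂_{m} f) := by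
  have h1 : (inner ℝ · m : Plane → ℝ).HasTemperateGrowth := by fun_prop
  have h1c : (fun x : Plane => ((inner ℝ x m : ℝ) : ℂ)).HasTemperateGrowth := by fun_prop
  rw [SchwartzMap.lineDeriv_eq_fourierMultiplierCLM, SchwartzMap.lineDeriv_eq_fourierMultiplierCLM,
    map_smul, ← SchwartzMap.fourierMultiplierCLM_ofReal ℂ h1,
    ← SchwartzMap.fourierMultiplierCLM_ofReal ℂ h1, lowFreq]
  congr 1
  refine (SchwartzMap.fourierMultiplierCLM_fourierMultiplierCLM_apply h1c
    (cutoff_hasTemperateGrowth R) f).trans ?_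
  rw [mul_comm]
  exact (SchwartzMap.fourierMultiplierCLM_fourierMultiplierCLM_apply (cutoff_hasTemperateGrowth R)
    h1c f).symm

/-- The low frequency projection is an average of translates. -/
lemma lowFreq_apply (R : ℝ) (f : 𝓢(Plane, ℂ)) (η : Plane) :
    lowFreq R f η = ∫ s, kernel s * f (η - R⁻¹ • s) := by
  set G : Plane → ℂ := fun w => Real.fourierChar (inner ℝ w η) • 𝓕 (f : Plane → ℂ) w with hG
  have hGi : Integrable G := by
    have := (𝓕 f).integrable (μ := volume)
    rw [SchwartzMap.fourier_coe] at this
    refine this.norm.mono' ?_ (Filter.Eventually.of_forall fun w => by simp [hG])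
    refine Continuous.aestronglyMeasurable ?_
    have hc : Continuous (𝓕 (f : Plane → ℂ)) := by
      rw [← SchwartzMap.fourier_coe]; exact (𝓕 f).continuous
    exact (Real.continuous_fourierChar.comp (by fun_prop)).smul hc
  -- The multiplication formula, with the dilation by `R⁻¹` built into the pairing so that no change
  -- of variables is needed.
  have key := VectorFourier.integral_fourierIntegral_smul_eq_flip (μ := volume) (ν := volume)
    (L := R⁻¹ • (innerₗ Plane)) Real.continuous_fourierChar
    (by simp only [LinearMap.smul_apply, innerₗ_apply_apply]; fun_prop) kernel.integrable hGi
  have h1 : ∀ w, VectorFourier.fourierIntegral Real.fourierChar volume (R⁻¹ • (innerₗ Plane))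
      kernel w = cutoff R w := by
    intro w
    rw [cutoff, ← fourier_kernel, Real.fourier_eq]
    simp only [VectorFourier.fourierIntegral, LinearMap.smul_apply, innerₗ_apply_apply,
      inner_smul_right, smul_eq_mul]
  have h2 : ∀ s, VectorFourier.fourierIntegral Real.fourierChar volume
      (R⁻¹ • (innerₗ Plane)).flip G s = f (η - R⁻¹ • s) := by
    intro s
    have : (f : Plane → ℂ) (η - R⁻¹ • s) = 𝓕⁻ (𝓕 (f : Plane → ℂ)) (η - R⁻¹ • s) := by
      rw [← SchwartzMap.fourier_coe, ← SchwartzMap.fourierInv_coe,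
        FourierTransform.fourierInv_fourier_eq]
    rw [this, Real.fourierInv_eq]
    simp only [VectorFourier.fourierIntegral, LinearMap.flip_apply, LinearMap.smul_apply,
      innerₗ_apply_apply, hG, smul_eq_mul, smul_smul]
    congr 1; ext w
    rw [← AddChar.map_add_eq_mul]
    congr 2
    rw [inner_sub_right, inner_smul_right, real_inner_comm s w]; ring
  simp only [h1, h2, smul_eq_mul] at key
  rw [← key, lowFreq, SchwartzMap.fourierMultiplierCLM_apply, SchwartzMap.fourierInv_coe,
    Real.fourierInv_eq]
  congr 1; ext w
  rw [SchwartzMap.smulLeftCLM_apply_apply (cutoff_hasTemperateGrowth R), hG,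
    ← SchwartzMap.fourier_coe, smul_eq_mul, mul_smul_comm]

/-- The high frequency part. -/
def highFreq (R : ℝ) (f : 𝓢(Plane, ℂ)) : 𝓢(Plane, ℂ) := f - lowFreq R f

lemma fourier_highFreq (R : ℝ) (f : 𝓢(Plane, ℂ)) (w : Plane) :
    𝓕 (highFreq R f) w = (1 - cutoff R w) * 𝓕 f w := by
  have h : 𝓕 (f - lowFreq R f) = 𝓕 f - 𝓕 (lowFreq R f) :=
    map_sub (FourierTransform.fourierCLM ℂ 𝓢(Plane, ℂ)) _ _
  rw [highFreq, h, sub_apply, fourier_lowFreq]; ring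

lemma lineDeriv_highFreq (R : ℝ) (f : 𝓢(Plane, ℂ)) (m : Plane) :
    ∂_{m} (highFreq R f) = highFreq R (∂_{m} f) := by
  rw [highFreq, highFreq, ← lineDeriv_lowFreq]
  exact map_sub (LineDeriv.lineDerivOpCLM ℂ 𝓢(Plane, ℂ) m) _ _

/-! ### Plancherel, Bernstein and commutator bounds -/

lemma eLpNorm_schwartz_ne_top (f : 𝓢(Plane, ℂ)) : eLpNorm f 2 volume ≠ ⊤ := by
  have h : MemLp (f : Plane → ℂ) 2 volume := f.memLp 2 volume
  exact h.2.ne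

lemma eLpNorm_fourier (f : 𝓢(Plane, ℂ)) :
    eLpNorm (𝓕 f : 𝓢(Plane, ℂ)) 2 volume = eLpNorm f 2 volume := by
  have h := SchwartzMap.norm_fourier_toL2_eq f
  rw [SchwartzMap.norm_toLp, SchwartzMap.norm_toLp] at h
  rw [← ENNReal.ofReal_toReal (eLpNorm_schwartz_ne_top (𝓕 f)),
    ← ENNReal.ofReal_toReal (eLpNorm_schwartz_ne_top f), h]

lemma norm_one_sub_cutoff_le (R : ℝ) (w : Plane) : ‖1 - cutoff R w‖ ≤ 1 := by
  rw [cutoff, ← Complex.ofReal_one, ← Complex.ofReal_sub, Complex.norm_real, Real.norm_eq_abs,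
    abs_of_nonneg (by linarith [bump.le_one (x := R⁻¹ • w)])]
  linarith [bump.nonneg (x := R⁻¹ • w)]

lemma eLpNorm_highFreq_le (R : ℝ) (f : 𝓢(Plane, ℂ)) :
    eLpNorm (highFreq R f) 2 volume ≤ eLpNorm f 2 volume := by
  rw [← eLpNorm_fourier, ← eLpNorm_fourier f]
  refine eLpNorm_mono fun w => ?_
  rw [fourier_highFreq, norm_mul]
  exact mul_le_of_le_one_left (norm_nonneg _) (norm_one_sub_cutoff_le R w)

/-- Bernstein's inequality for the high frequency part. -/
lemma eLpNorm_highFreq_le_deriv {R : ℝ} (hR : 0 < R) (f : 𝓢(Plane, ℂ)) :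
    ENNReal.ofReal (R / 2) * eLpNorm (highFreq R f) 2 volume ≤
      ∑ c : Fin 2, eLpNorm (∂_{EuclideanSpace.single c (1 : ℝ)} (highFreq R f) : 𝓢(Plane, ℂ)) 2 volume := by
  set h := highFreq R f
  have hd : ∀ (c : Fin 2) (w : Plane), 𝓕 (∂_{EuclideanSpace.single c (1 : ℝ)} h) w =
      (2 * Real.pi * Complex.I) * (w c : ℂ) * 𝓕 h w := by
    intro c w
    have h1 : (inner ℝ · (EuclideanSpace.single c (1 : ℝ)) : Plane → ℝ).HasTemperateGrowth := by
      fun_prop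
    rw [SchwartzMap.fourier_lineDerivOp_eq, smul_apply,
      SchwartzMap.smulLeftCLM_apply_apply h1]
    simp [EuclideanSpace.inner_single_right, mul_assoc]
  have hpt : ∀ w, ‖((R / 2 : ℝ) : ℂ) * 𝓕 h w‖ ≤
      ‖(‖𝓕 (∂_{EuclideanSpace.single (0 : Fin 2) (1 : ℝ)} h) w‖ +
        ‖𝓕 (∂_{EuclideanSpace.single (1 : Fin 2) (1 : ℝ)} h) w‖ : ℝ)‖ := by
    intro w
    rw [Real.norm_of_nonneg (by positivity), hd, hd, norm_mul, norm_mul _ (𝓕 h w),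
      norm_mul _ (𝓕 h w), ← add_mul]
    -- On this ball the cutoff equals `1` and the high part vanishes; outside it `2π(|w₀| + |w₁|) ≥
    -- 2π‖w‖ > R/2`.
    by_cases hw : ‖w‖ ≤ R / (4 * Real.pi)
    · have : 𝓕 h w = 0 := by
        rw [fourier_highFreq, cutoff, bump.one_of_mem_closedBall, Complex.ofReal_one, sub_self,
          zero_mul]
        rw [mem_closedBall_zero_iff, norm_smul, norm_inv, Real.norm_of_nonneg hR.le]
        change _ ≤ (4 * Real.pi)⁻¹
        rw [inv_mul_le_iff₀ hR]
        exact hw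
      simp [this]
    · push Not at hw
      refine mul_le_mul_of_nonneg_right ?_ (norm_nonneg _)
      simp only [norm_mul, Complex.norm_real, Complex.norm_I,
        Real.norm_of_nonneg (by positivity : (0 : ℝ) ≤ R / 2), Real.norm_of_nonneg Real.pi_pos.le]
      have h3 : ‖w‖ ≤ ‖w 0‖ + ‖w 1‖ := by
        rw [EuclideanSpace.norm_eq, Fin.sum_univ_two]
        rw [Real.sqrt_le_left (by positivity)]
        nlinarith [norm_nonneg (w 0), norm_nonneg (w 1)]
      have h4 : R < ‖w‖ * (4 * Real.pi) := by rwa [div_lt_iff₀ (by positivity)] at hw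
      have := Real.pi_pos
      simp only [Complex.norm_ofNat]
      nlinarith
  have hm : ∀ g : 𝓢(Plane, ℂ), AEStronglyMeasurable (fun w => ‖g w‖) volume := fun g =>
    g.continuous.norm.aestronglyMeasurable
  calc ENNReal.ofReal (R / 2) * eLpNorm h 2 volume
      = eLpNorm (fun w => ((R / 2 : ℝ) : ℂ) * 𝓕 h w) 2 volume := by
        rw [← eLpNorm_fourier]
        have := eLpNorm_const_smul ((R / 2 : ℝ) : ℂ) (𝓕 h : 𝓢(Plane, ℂ)) 2 volume
        rw [← ofReal_norm, Complex.norm_real, Real.norm_of_nonneg (by positivity)] at this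
        rw [← this]; rfl
    _ ≤ eLpNorm (fun w => ‖𝓕 (∂_{EuclideanSpace.single (0 : Fin 2) (1 : ℝ)} h) w‖ +
        ‖𝓕 (∂_{EuclideanSpace.single (1 : Fin 2) (1 : ℝ)} h) w‖) 2 volume := eLpNorm_mono hpt
    _ ≤ _ := by
        refine (eLpNorm_add_le (hm _) (hm _) (by norm_num)).trans ?_
        rw [eLpNorm_norm, eLpNorm_norm, eLpNorm_fourier, eLpNorm_fourier, Fin.sum_univ_two]

/-- Minkowski's inequality for averages of translates. -/
lemma lintegral_sq_average_le (R : ℝ) {k g : Plane → ℝ≥0∞} (hk : Measurable k)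
    (hg : Measurable g) :
    ∫⁻ η, (∫⁻ s, k s * g (η - R⁻¹ • s)) ^ 2 ≤ (∫⁻ s, k s) ^ 2 * ∫⁻ η, g η ^ 2 := by
  have hsub : Measurable fun p : Plane × Plane => p.1 - R⁻¹ • p.2 := by fun_prop
  have hCS : ∀ η, (∫⁻ s, k s * g (η - R⁻¹ • s)) ^ 2 ≤
      (∫⁻ s, k s) * ∫⁻ s, k s * g (η - R⁻¹ • s) ^ 2 := by
    intro η
    have hgη : Measurable fun s => g (η - R⁻¹ • s) := by fun_prop
    -- Cauchy–Schwarz with respect to the measure `k ds`, by splitting `k = k^{1/2} k^{1/2}`.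
    have h := ENNReal.lintegral_mul_le_Lp_mul_Lq (volume : Measure Plane)
      (p := 2) (q := 2) (by constructor <;> norm_num)
      (f := fun s => k s ^ (1 / 2 : ℝ)) (g := fun s => k s ^ (1 / 2 : ℝ) * g (η - R⁻¹ • s))
      (by fun_prop) (by fun_prop)
    have e1 : ∀ x : ℝ≥0∞, x ^ (1 / 2 : ℝ) * x ^ (1 / 2 : ℝ) = x := fun x => by
      rw [← ENNReal.rpow_add_of_nonneg _ _ (by norm_num) (by norm_num)]; norm_num
    have e2 : ∀ x : ℝ≥0∞, (x ^ (1 / 2 : ℝ)) ^ 2 = x := fun x => by rw [sq, e1]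
    simp only [Pi.mul_apply, ← mul_assoc, e1, ENNReal.rpow_two, mul_pow, e2] at h
    calc _ ≤ _ := pow_le_pow_left' h 2
      _ = _ := by rw [mul_pow, e2, e2]
  calc _ ≤ ∫⁻ η, (∫⁻ s, k s) * ∫⁻ s, k s * g (η - R⁻¹ • s) ^ 2 := lintegral_mono hCS
    _ = (∫⁻ s, k s) * ∫⁻ η, ∫⁻ s, k s * g (η - R⁻¹ • s) ^ 2 := by
        refine lintegral_const_mul _ (Measurable.lintegral_prod_right ?_)
        exact (hk.comp measurable_snd).mul ((hg.comp hsub).pow_const 2)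
    _ = (∫⁻ s, k s) * ∫⁻ s, ∫⁻ η, k s * g (η - R⁻¹ • s) ^ 2 := by
        rw [lintegral_lintegral_swap]
        exact ((hk.comp measurable_snd).mul ((hg.comp hsub).pow_const 2)).aemeasurable
    _ = (∫⁻ s, k s) * ∫⁻ s, k s * ∫⁻ η, g η ^ 2 := by
        congr 1
        refine lintegral_congr fun s => ?_
        rw [lintegral_const_mul _ (by fun_prop),
          lintegral_sub_right_eq_self (fun η => g η ^ 2) (R⁻¹ • s)]
    _ = _ := by rw [lintegral_mul_const _ hk, sq, mul_assoc]

/-- The first absolute moment of the kernel. -/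
def kernelMoment : ℝ≥0∞ := ∫⁻ s, ‖kernel s‖ₑ * ‖s‖ₑ

lemma kernelMoment_ne_top : kernelMoment ≠ ⊤ := by
  have h : Integrable (fun s : Plane => ‖s‖ ^ 1 * ‖kernel s‖) := kernel.integrable_pow_mul volume 1
  have h2 := h.hasFiniteIntegral
  rw [hasFiniteIntegral_iff_enorm] at h2
  refine ne_of_lt (lt_of_le_of_lt (lintegral_mono fun s => ?_) h2)
  rw [enorm_mul, enorm_norm, pow_one, enorm_norm, mul_comm]

lemma integrable_kernel_mul (R : ℝ) (f : 𝓢(Plane, ℂ)) (η : Plane) :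
    Integrable fun s => kernel s * f (η - R⁻¹ • s) := by
  have hk : Integrable (kernel : Plane → ℂ) := kernel.integrable (μ := volume)
  obtain ⟨C, -, hC⟩ := f.decay 0 0
  refine hk.mul_bdd (c := C) ?_ (Filter.Eventually.of_forall fun s => by
    simpa using hC (η - R⁻¹ • s))
  exact (f.continuous.comp (by fun_prop)).aestronglyMeasurable

lemma eLpNorm_two_sq {α : Type*} [MeasurableSpace α] (μ : Measure α) (f : α → ℂ) :
    eLpNorm f 2 μ ^ 2 = ∫⁻ x, ‖f x‖ₑ ^ 2 ∂μ := by
  have h := eLpNorm_nnreal_pow_eq_lintegral (μ := μ) (f := f) (p := 2) (by norm_num)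
  simpa using h

/-- Commutator of the low frequency projection with a Lipschitz multiplier. -/
lemma eLpNorm_commutator_le {R : ℝ} (hR : 0 < R) {L : ℝ≥0} {ψ : Plane → ℂ}
    (hψ : LipschitzWith L ψ) {f q : 𝓢(Plane, ℂ)} (hq : ∀ η, q η = ψ η * f η) :
    eLpNorm (fun η => ψ η * lowFreq R f η - lowFreq R q η) 2 volume ≤
      L * ENNReal.ofReal R⁻¹ * kernelMoment * eLpNorm f 2 volume := by
  have hpt : ∀ η, ‖ψ η * lowFreq R f η - lowFreq R q η‖ₑ ≤
      ∫⁻ s, (L * ENNReal.ofReal R⁻¹ * (‖kernel s‖ₑ * ‖s‖ₑ)) * ‖f (η - R⁻¹ • s)‖ₑ := by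
    intro η
    rw [lowFreq_apply, lowFreq_apply, ← integral_const_mul,
      ← integral_sub ((integrable_kernel_mul R f η).const_mul _) (integrable_kernel_mul R q η)]
    refine (enorm_integral_le_lintegral_enorm _).trans (lintegral_mono fun s => ?_)
    rw [hq, show ψ η * (kernel s * f (η - R⁻¹ • s)) -
      kernel s * (ψ (η - R⁻¹ • s) * f (η - R⁻¹ • s)) =
      (ψ η - ψ (η - R⁻¹ • s)) * kernel s * f (η - R⁻¹ • s) by ring, enorm_mul, enorm_mul]
    refine mul_le_mul_left ?_ _
    -- The difference of the two values of `ψ` gains `|s|/R`; this is the source of the first moment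
    -- of the kernel.
    have := hψ.edist_le_mul η (η - R⁻¹ • s)
    rw [edist_eq_enorm_sub, edist_eq_enorm_sub, sub_sub_cancel, enorm_smul,
      Real.enorm_of_nonneg (by positivity)] at this
    calc _ ≤ _ := mul_le_mul_left this _
      _ = _ := by ring
  rw [← ENNReal.pow_le_pow_left_iff two_ne_zero, mul_pow, eLpNorm_two_sq,
    eLpNorm_two_sq]
  have hkm : Measurable fun s : Plane => ‖kernel s‖ₑ * ‖s‖ₑ :=
    kernel.continuous.measurable.enorm.mul measurable_enorm
  calc _ ≤ _ := lintegral_mono fun η => pow_le_pow_left' (hpt η) 2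
    _ ≤ _ := lintegral_sq_average_le R (hkm.const_mul _) f.continuous.measurable.enorm
    _ = _ := by rw [lintegral_const_mul _ hkm, kernelMoment]

/-- Energy estimate: a function `a` with `∂ a = ψ a + r`, where `ψ` is Lipschitz and much smaller
than `R`, has a small high frequency part. -/
lemma energy_estimate {R : ℝ} (hR : 0 < R) {L : ℝ≥0} {ψ : Fin 2 → Plane → ℂ}
    (hψ : ∀ c, LipschitzWith L (ψ c)) (hψb : ∀ c η, ‖ψ c η‖ ≤ R / 8)
    (a : 𝓢(Plane, ℂ)) (r : Fin 2 → 𝓢(Plane, ℂ))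
    (had : ∀ c η, (∂_{EuclideanSpace.single c (1 : ℝ)} a : 𝓢(Plane, ℂ)) η = ψ c η * a η + r c η) :
    ENNReal.ofReal (R / 4) * eLpNorm (highFreq R a) 2 volume ≤
      ∑ c, (L * ENNReal.ofReal R⁻¹ * kernelMoment * eLpNorm a 2 volume +
        eLpNorm (r c) 2 volume) := by
  set N := eLpNorm (highFreq R a) 2 volume with hN
  have hc : ∀ c, eLpNorm (∂_{EuclideanSpace.single c (1 : ℝ)} (highFreq R a) : 𝓢(Plane, ℂ)) 2
      volume ≤ ENNReal.ofReal (R / 8) * N +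
        (L * ENNReal.ofReal R⁻¹ * kernelMoment * eLpNorm a 2 volume +
        eLpNorm (r c) 2 volume) := by
    intro c
    -- `ψ` is only Lipschitz, but `ψa` is Schwartz, being the difference of two Schwartz functions.
    set q : 𝓢(Plane, ℂ) := ∂_{EuclideanSpace.single c (1 : ℝ)} a - r c with hqdef
    have hq : ∀ η, q η = ψ c η * a η := fun η => by
      rw [hqdef, sub_apply, had]; ring
    -- With `P` the high frequency projection, `∂Pa = P(ψa + r) = ψPa + [P,ψ]a + Pr`, and `[P,ψ]` is
    -- the low frequency commutator up to sign.
    have hfun : (∂_{EuclideanSpace.single c (1 : ℝ)} (highFreq R a) : 𝓢(Plane, ℂ)) =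
        (fun η => ψ c η * highFreq R a η) +
          ((fun η => ψ c η * lowFreq R a η - lowFreq R q η) + (highFreq R (r c) : Plane → ℂ)) := by
      funext η
      have e : lowFreq R (∂_{EuclideanSpace.single c (1 : ℝ)} a) =
          lowFreq R q + lowFreq R (r c) := by rw [← map_add, hqdef, sub_add_cancel]
      rw [lineDeriv_highFreq]
      simp only [highFreq, Pi.add_apply, sub_apply, e, add_apply, had]
      ring
    have m1 : AEStronglyMeasurable (fun η => ψ c η * highFreq R a η) volume :=
      ((hψ c).continuous.mul (highFreq R a).continuous).aestronglyMeasurable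
    have m2 : AEStronglyMeasurable (fun η => ψ c η * lowFreq R a η - lowFreq R q η) volume :=
      (((hψ c).continuous.mul (lowFreq R a).continuous).sub
        (lowFreq R q).continuous).aestronglyMeasurable
    have m3 : AEStronglyMeasurable (highFreq R (r c) : Plane → ℂ) volume :=
      (highFreq R (r c)).continuous.aestronglyMeasurable
    rw [hfun]
    refine (eLpNorm_add_le m1 (m2.add m3) (by norm_num)).trans (add_le_add ?_
      ((eLpNorm_add_le m2 m3 (by norm_num)).trans (add_le_add
        (eLpNorm_commutator_le hR (hψ c) hq) (eLpNorm_highFreq_le R (r c)))))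
    refine eLpNorm_le_mul_eLpNorm_of_ae_le_mul (Filter.Eventually.of_forall fun η => ?_) 2
    rw [norm_mul]
    exact mul_le_mul_of_nonneg_right (hψb c η) (norm_nonneg _)
  have h := (eLpNorm_highFreq_le_deriv hR a).trans (Finset.sum_le_sum fun c _ => hc c)
  rw [Finset.sum_add_distrib, Fin.sum_const, two_smul, ← add_mul,
    ← ENNReal.ofReal_add (by positivity) (by positivity), ← hN,
    show R / 2 = R / 4 + R / 4 by ring, show R / 8 + R / 8 = R / 4 by ring,
    ENNReal.ofReal_add (by positivity) (by positivity), add_mul] at h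
  -- The two coordinates contribute `2 · R/8 = R/4`, half of the factor `R/2` on the left. Absorbing
  -- it requires the norm to be finite.
  refine (ENNReal.add_le_add_iff_left ?_).1 h
  exact ENNReal.mul_ne_top ENNReal.ofReal_ne_top (eLpNorm_schwartz_ne_top _)

/-! ### Geometry of the support and of the phase gradient -/

/-- A closed set containing the support of `b(t,ξ,·)` for `(j,m)`-adapted symbols `b`. -/
def symbolRegion (j m : ℝ) (ξ : Plane) : Set Plane :=
  {η | (0 ≤ η 0 ∧ η 0 ≤ η 1) ∧ (0 ≤ (ξ - η) 0 ∧ (ξ - η) 0 ≤ (ξ - η) 1) ∧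
    ((2 : ℝ) ^ (j - 1) ≤ ‖η‖ ∧ ‖η‖ ≤ (2 : ℝ) ^ (j + 1)) ∧
    ((2 : ℝ) ^ (j - 1) ≤ ‖ξ - η‖ ∧ ‖ξ - η‖ ≤ (2 : ℝ) ^ (j + 1)) ∧
    ‖‖ξ‖ • η - ‖η‖ • ξ‖ ≤ (2 : ℝ) ^ (-m + 5) * ‖η‖ * ‖ξ‖}

/-- Closedness makes `b(t,ξ,·)` vanish near every point outside the region, so its derivative
vanishes there too. For this reason the region uses weak inequalities and a continuous expression in
place of the angle. -/
lemma isClosed_symbolRegion (j m : ℝ) (ξ : Plane) : IsClosed (symbolRegion j m ξ) := by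
  simp only [symbolRegion, ofPred_and]
  refine (IsClosed.inter ?_ ?_).inter ((IsClosed.inter ?_ ?_).inter
    ((IsClosed.inter ?_ ?_).inter ((IsClosed.inter ?_ ?_).inter ?_))) <;>
  exact isClosed_le (by fun_prop) (by fun_prop)

/-- The square of the left side is `2‖x‖²‖y‖²(1 - cos θ)`, and `1 - cos θ ≤ θ²/2`. -/
lemma norm_smul_sub_le_angle {E : Type*} [NormedAddCommGroup E] [InnerProductSpace ℝ E]
    (x y : E) {δ : ℝ} (h : InnerProductGeometry.angle x y ≤ δ) :
    ‖‖x‖ • y - ‖y‖ • x‖ ≤ δ * ‖y‖ * ‖x‖ := by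
  have h0 := InnerProductGeometry.angle_nonneg x y
  have hδ : 0 ≤ δ := h0.trans h
  refine le_of_sq_le_sq ?_ (by positivity)
  rw [@norm_sub_sq ℝ, norm_smul, norm_smul, norm_norm, norm_norm, inner_smul_left,
    inner_smul_right]
  have hc := InnerProductGeometry.cos_angle_mul_norm_mul_norm x y
  have h1 := Real.one_sub_sq_div_two_le_cos (x := InnerProductGeometry.angle x y)
  have h2 : InnerProductGeometry.angle x y ^ 2 ≤ δ ^ 2 := pow_le_pow_left₀ h0 h 2
  rw [real_inner_comm, ← hc]
  simp only [RCLike.re_to_real, conj_trivial]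
  have h3 : 0 ≤ (‖x‖ * ‖y‖) ^ 2 := sq_nonneg _
  nlinarith [mul_le_mul_of_nonneg_left h1 h3, mul_le_mul_of_nonneg_left h2 h3]

lemma mem_symbolRegion {j m : ℝ} {ξ η : Plane} (h1 : η ∈ Theta j) (h2 : ξ - η ∈ Theta j)
    (h3 : InnerProductGeometry.angle ξ η ≤ (2 : ℝ) ^ (-m + 5)) : η ∈ symbolRegion j m ξ := by
  have key : ∀ w : Plane, w ∈ Theta j → 0 ≤ w 0 ∧ w 0 ≤ w 1 := by
    rintro w ⟨a, b, -⟩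
    have hp : (0 : ℝ) < 2 ^ (-10 : ℝ) := by positivity
    have hp1 : (2 : ℝ) ^ (-10 : ℝ) ≤ 1 := Real.rpow_le_one_of_one_le_of_nonpos (by norm_num)
      (by norm_num)
    have : 0 < w 1 := by
      by_contra hn
      nlinarith
    exact ⟨a.le, by nlinarith⟩
  exact ⟨key η h1, key _ h2, h1.2.2, h2.2.2, norm_smul_sub_le_angle ξ η h3⟩

section region

variable {j m : ℝ} {ξ η : Plane}

lemma norm_pos_of_mem (h : η ∈ symbolRegion j m ξ) : 0 < ‖η‖ :=
  lt_of_lt_of_le (by positivity) h.2.2.1.1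

lemma norm_sub_pos_of_mem (h : η ∈ symbolRegion j m ξ) : 0 < ‖ξ - η‖ :=
  lt_of_lt_of_le (by positivity) h.2.2.2.1.1

/-- Both `η` and `ξ-η` lie in the first quadrant, so the comparison holds coordinatewise. -/
lemma norm_le_of_mem (h : η ∈ symbolRegion j m ξ) : ‖η‖ ≤ ‖ξ‖ := by
  obtain ⟨⟨h1, h2⟩, ⟨h3, h4⟩, -⟩ := h
  simp only [PiLp.sub_apply] at h3 h4
  rw [EuclideanSpace.norm_eq, EuclideanSpace.norm_eq]
  refine Real.sqrt_le_sqrt (Finset.sum_le_sum fun i _ => ?_)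
  rw [Real.norm_eq_abs, Real.norm_eq_abs, sq_abs, sq_abs]
  fin_cases i
  · simp only [Fin.zero_eta]; nlinarith
  · simp only [Fin.mk_one]; nlinarith

end region

/-- The gradient of `η ↦ |ξ - η| + |η|`. -/
def phaseGrad (ξ η : Plane) : Plane := ‖η‖⁻¹ • η - ‖ξ - η‖⁻¹ • (ξ - η)

lemma norm_unit_sub_le {E : Type*} [NormedAddCommGroup E] [NormedSpace ℝ E] {x y : E}
    (hx : 0 < ‖x‖) (hy : 0 < ‖y‖) :
    ‖‖x‖⁻¹ • x - ‖y‖⁻¹ • y‖ ≤ 2 * ‖x‖⁻¹ * ‖x - y‖ := by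
  have h : ‖x‖⁻¹ • x - ‖y‖⁻¹ • y = ‖x‖⁻¹ • ((x - y) + ((‖y‖ - ‖x‖) * ‖y‖⁻¹) • y) := by
    rw [smul_add, smul_smul, smul_sub, sub_mul, mul_inv_cancel₀ hy.ne', mul_sub, mul_one,
      ← mul_assoc, inv_mul_cancel₀ hx.ne', one_mul, sub_smul]
    abel
  rw [h, norm_smul, norm_inv, norm_norm, mul_comm 2, mul_assoc]
  refine mul_le_mul_of_nonneg_left ?_ (by positivity)
  refine (norm_add_le _ _).trans ?_
  rw [norm_smul, norm_mul, norm_inv, norm_norm, mul_assoc, inv_mul_cancel₀ hy.ne', mul_one,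
    Real.norm_eq_abs, abs_sub_comm]
  linarith [abs_norm_sub_norm_le x y]

/-- The gradient is a difference of two unit vectors. With `δ = 2^{-m+5}`, they lie within `δ` and
`8δ` of the direction of `ξ`, and `9δ ≤ 2⁴δ`. -/
lemma norm_phaseGrad_le {j m : ℝ} {ξ η : Plane} (h : η ∈ symbolRegion j m ξ) :
    ‖phaseGrad ξ η‖ ≤ (2 : ℝ) ^ (-m + 9) := by
  have hη := norm_pos_of_mem h
  have hx := norm_sub_pos_of_mem h
  have hle := norm_le_of_mem h
  have hξ : 0 < ‖ξ‖ := hη.trans_le hle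
  obtain ⟨-, -, ⟨-, h6⟩, ⟨h7, -⟩, h9⟩ := h
  set δ : ℝ := (2 : ℝ) ^ (-m + 5) with hδ
  set e : Plane := ‖ξ‖⁻¹ • ξ with he
  have hen : ‖e‖ = 1 := by rw [he, norm_smul, norm_inv, norm_norm, inv_mul_cancel₀ hξ.ne']
  have hξe : ξ = ‖ξ‖ • e := by rw [he, smul_smul, mul_inv_cancel₀ hξ.ne', one_smul]
  have h1 : ‖η - ‖η‖ • e‖ ≤ δ * ‖η‖ := by
    have : ‖ξ‖ • η - ‖η‖ • ξ = ‖ξ‖ • (η - ‖η‖ • e) := by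
      rw [smul_sub, smul_comm ‖ξ‖ ‖η‖ e, ← hξe]
    rw [this, norm_smul, norm_norm, mul_comm] at h9
    exact le_of_mul_le_mul_right h9 hξ
  -- `ξ-η` is within `δ‖η‖` of `(‖ξ‖-‖η‖)e`; replacing that coefficient by `‖ξ-η‖` costs at most the
  -- same again.
  have h2 : ‖(ξ - η) - ‖ξ - η‖ • e‖ ≤ 2 * (δ * ‖η‖) := by
    have e1 : (ξ - η) - (‖ξ‖ - ‖η‖) • e = -(η - ‖η‖ • e) := by
      rw [sub_smul, ← hξe]; abel
    have e2 : ‖(ξ - η) - (‖ξ‖ - ‖η‖) • e‖ ≤ δ * ‖η‖ := by rw [e1, norm_neg]; exact h1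
    have e3 : |‖ξ - η‖ - (‖ξ‖ - ‖η‖)| ≤ δ * ‖η‖ := by
      have := abs_norm_sub_norm_le (ξ - η) ((‖ξ‖ - ‖η‖) • e)
      rw [norm_smul, hen, mul_one, Real.norm_of_nonneg (sub_nonneg.2 hle)] at this
      exact this.trans e2
    have e4 : (ξ - η) - ‖ξ - η‖ • e =
        ((ξ - η) - (‖ξ‖ - ‖η‖) • e) - (‖ξ - η‖ - (‖ξ‖ - ‖η‖)) • e := by
      rw [sub_smul (‖ξ - η‖)]; abel
    rw [e4]
    refine (norm_sub_le _ _).trans ?_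
    rw [norm_smul, hen, mul_one, Real.norm_eq_abs]
    linarith
  have h3 : ‖‖η‖⁻¹ • η - e‖ ≤ δ := by
    have : ‖η‖⁻¹ • η - e = ‖η‖⁻¹ • (η - ‖η‖ • e) := by
      rw [smul_sub, smul_smul, inv_mul_cancel₀ hη.ne', one_smul]
    rw [this, norm_smul, norm_inv, norm_norm, inv_mul_le_iff₀ hη, mul_comm]
    exact h1
  have h4 : ‖‖ξ - η‖⁻¹ • (ξ - η) - e‖ ≤ 8 * δ := by
    have : ‖ξ - η‖⁻¹ • (ξ - η) - e = ‖ξ - η‖⁻¹ • ((ξ - η) - ‖ξ - η‖ • e) := by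
      rw [smul_sub ‖ξ - η‖⁻¹ (ξ - η), smul_smul (‖ξ - η‖⁻¹) (‖ξ - η‖), inv_mul_cancel₀ hx.ne', one_smul]
    rw [this, norm_smul, norm_inv, norm_norm, inv_mul_le_iff₀ hx]
    refine h2.trans ?_
    -- Both vectors lie in the annulus with radii `2^{j-1}` and `2^{j+1}`.
    have : ‖η‖ ≤ 4 * ‖ξ - η‖ := by
      refine h6.trans (le_trans (le_of_eq ?_) (mul_le_mul_of_nonneg_left h7 (by norm_num)))
      rw [show j + 1 = (j - 1) + 2 by ring, Real.rpow_add (by norm_num)]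
      norm_num; ring
    have hδ0 : 0 ≤ δ := by positivity
    nlinarith [mul_le_mul_of_nonneg_left this hδ0]
  have h5 : phaseGrad ξ η = (‖η‖⁻¹ • η - e) - (‖ξ - η‖⁻¹ • (ξ - η) - e) := by
    rw [phaseGrad]; abel
  rw [h5]
  refine (norm_sub_le _ _).trans ((add_le_add h3 h4).trans ?_)
  rw [show -m + 9 = (-m + 5) + 4 by ring, Real.rpow_add (by norm_num), ← hδ]
  have hδ0 : 0 ≤ δ := by positivity
  norm_num
  linarith

/-- Normalization is Lipschitz with constant `2/‖x‖ ≤ 2 · 2^{1-j}`, and it is applied to `η` and to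
`ξ-η`. The comparison is made directly between two points, so convexity of the region plays no role.
-/
lemma norm_phaseGrad_sub_le {j m : ℝ} {ξ η η' : Plane} (h : η ∈ symbolRegion j m ξ)
    (h' : η' ∈ symbolRegion j m ξ) :
    ‖phaseGrad ξ η - phaseGrad ξ η'‖ ≤ (2 : ℝ) ^ (3 - j) * ‖η - η'‖ := by
  have e : phaseGrad ξ η - phaseGrad ξ η' = (‖η‖⁻¹ • η - ‖η'‖⁻¹ • η') -
      (‖ξ - η‖⁻¹ • (ξ - η) - ‖ξ - η'‖⁻¹ • (ξ - η')) := by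
    rw [phaseGrad, phaseGrad]; abel
  have b : ∀ w : Plane, (2 : ℝ) ^ (j - 1) ≤ ‖w‖ → ‖w‖⁻¹ ≤ (2 : ℝ) ^ (1 - j) := by
    intro w hw
    rw [show 1 - j = -(j - 1) by ring, Real.rpow_neg (by norm_num)]
    exact inv_anti₀ (by positivity) hw
  have h1 := norm_unit_sub_le (norm_pos_of_mem h) (norm_pos_of_mem h')
  have h2 := norm_unit_sub_le (norm_sub_pos_of_mem h) (norm_sub_pos_of_mem h')
  rw [show (ξ - η) - (ξ - η') = -(η - η') by abel, norm_neg] at h2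
  have b1 := b η h.2.2.1.1
  have b2 := b (ξ - η) h.2.2.2.1.1
  rw [e]
  refine (norm_sub_le _ _).trans ((add_le_add h1 h2).trans ?_)
  rw [show 3 - j = (1 - j) + 2 by ring, Real.rpow_add (by norm_num), ← add_mul]
  refine mul_le_mul_of_nonneg_right ?_ (norm_nonneg _)
  norm_num
  linarith

/-- Bounded Lipschitz extension. -/
lemma exists_bounded_lipschitz_extension {X : Type*} [PseudoMetricSpace X] {s : Set X}
    {K : ℝ≥0} {f : X → ℝ} {M : ℝ} (hM : 0 ≤ M) (hf : LipschitzOnWith K f s)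
    (hb : ∀ x ∈ s, |f x| ≤ M) :
    ∃ g : X → ℝ, LipschitzWith K g ∧ (∀ x, |g x| ≤ M) ∧ EqOn f g s := by
  obtain ⟨g, hg, hfg⟩ := hf.extend_real
  -- Truncating a Lipschitz extension keeps its constant and its values on `s`.
  refine ⟨fun x => max (-M) (min M (g x)), (hg.const_min M).const_max (-M), fun x => ?_,
    fun x hx => ?_⟩
  · rw [abs_le]
    exact ⟨le_max_left _ _, max_le (by linarith) (min_le_left _ _)⟩
  · have := abs_le.1 (hb x hx)
    have e := hfg hx
    simp only
    rw [← e, min_eq_right this.2, max_eq_right this.1]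

/-- The components of the gradient of the phase extend to bounded Lipschitz functions. -/
lemma exists_phase_extension (j m : ℝ) (ξ : Plane) {τ : ℝ} (hτ : |τ| ≤ 2) (c : Fin 2) :
    ∃ ψ : Plane → ℝ, LipschitzWith (Real.toNNReal ((2 : ℝ) ^ (4 - j))) ψ ∧
      (∀ η, |ψ η| ≤ (2 : ℝ) ^ (-m + 10)) ∧
      ∀ η ∈ symbolRegion j m ξ, τ * phaseGrad ξ η c = ψ η := by
  refine exists_bounded_lipschitz_extension (by positivity) ?_ ?_
  · refine LipschitzOnWith.of_dist_le_mul fun η h η' h' => ?_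
    rw [Real.coe_toNNReal _ (by positivity), dist_eq_norm, dist_eq_norm, ← mul_sub, norm_mul,
      ← PiLp.sub_apply]
    calc _ ≤ 2 * ((2 : ℝ) ^ (3 - j) * ‖η - η'‖) := mul_le_mul hτ
          ((PiLp.norm_apply_le _ c).trans (norm_phaseGrad_sub_le h h')) (norm_nonneg _)
          (by norm_num)
      _ = _ := by
        rw [show 4 - j = 1 + (3 - j) by ring, Real.rpow_add (by norm_num), Real.rpow_one]; ring
  · intro η h
    rw [abs_mul]
    calc _ ≤ 2 * (2 : ℝ) ^ (-m + 9) := mul_le_mul hτ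
          ((PiLp.norm_apply_le (phaseGrad ξ η) c).trans (norm_phaseGrad_le h)) (abs_nonneg _)
          (by norm_num)
      _ = _ := by
        rw [show -m + 10 = 1 + (-m + 9) by ring, Real.rpow_add two_pos 1, Real.rpow_one]

/-! ### Area of the support -/

lemma volume_strip (c A ρ : ℝ) :
    volume {η : Plane | η 1 ∈ Icc 0 A ∧ |η 0 - c * η 1| ≤ ρ} =
      ENNReal.ofReal (2 * ρ) * ENNReal.ofReal A := by
  set T : Set (ℝ × ℝ) := {p | p.2 ∈ Icc 0 A ∧ |p.1 - c * p.2| ≤ ρ} with hT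
  have hTm : MeasurableSet T := by
    rw [hT, ofPred_and]
    refine (measurableSet_Icc.preimage measurable_snd).inter
      (measurableSet_le (f := fun p : ℝ × ℝ => |p.1 - c * p.2|) ?_ measurable_const)
    exact (continuous_abs.comp (by fun_prop : Continuous fun p : ℝ × ℝ => p.1 - c * p.2)).measurable
  have hmp : MeasurePreserving (fun η : Plane => MeasurableEquiv.finTwoArrow (WithLp.ofLp η))
      volume volume :=
    (volume_preserving_finTwoArrow ℝ).comp (PiLp.volume_preserving_ofLp (Fin 2))
  have h1 := hmp.measure_preimage hTm.nullMeasurableSet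
  have h2 : volume {η : Plane | η 1 ∈ Icc 0 A ∧ |η 0 - c * η 1| ≤ ρ} = volume T := by
    rw [← h1]; rfl
  rw [h2, Measure.volume_eq_prod, Measure.prod_apply_symm hTm]
  have h3 : ∀ y, volume ((fun x => (x, y)) ⁻¹' T) =
      (Icc 0 A).indicator (fun _ => ENNReal.ofReal (2 * ρ)) y := by
    intro y
    by_cases hy : y ∈ Icc 0 A
    · rw [indicator_of_mem hy]
      have : (fun x => (x, y)) ⁻¹' T = Icc (c * y - ρ) (c * y + ρ) := by
        ext x
        change (y ∈ Icc 0 A ∧ |x - c * y| ≤ ρ) ↔ _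
        rw [and_iff_right hy, abs_le, mem_Icc]
        constructor <;> rintro ⟨a, b⟩ <;> constructor <;> linarith
      rw [this, Real.volume_Icc]
      congr 1; ring
    · rw [indicator_of_notMem hy]
      have : (fun x => (x, y)) ⁻¹' T = ∅ := by
        ext x
        exact ⟨fun h => hy h.1, False.elim⟩
      rw [this, measure_empty]
  simp_rw [h3]
  rw [lintegral_indicator_const measurableSet_Icc, Real.volume_Icc, sub_zero]

/-- The angular condition confines `η` to a strip of width `O(2^{j-m})` around the line through `ξ`,
of height `2^{j+1}`. Slicing horizontally avoids a rotation. -/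
lemma volume_symbolRegion_le (j m : ℝ) (ξ : Plane) :
    volume (symbolRegion j m ξ) ≤ ENNReal.ofReal ((2 : ℝ) ^ (2 * j - m + 9)) := by
  have hsub : symbolRegion j m ξ ⊆ {η : Plane | η 1 ∈ Icc 0 ((2 : ℝ) ^ (j + 1)) ∧
      |η 0 - ξ 0 / ξ 1 * η 1| ≤ (2 : ℝ) ^ (j - m + 7)} := by
    intro η h
    have hη := norm_pos_of_mem h
    have hξ : 0 < ‖ξ‖ := hη.trans_le (norm_le_of_mem h)
    obtain ⟨⟨a1, a2⟩, ⟨a3, a4⟩, ⟨-, h6⟩, -, h9⟩ := h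
    simp only [PiLp.sub_apply] at a3 a4
    have hξ1 : 0 < ξ 1 := by
      rcases lt_or_ge 0 (ξ 1) with h | h
      · exact h
      · exfalso
        have z1 : ξ 1 = 0 := by linarith
        have z0 : ξ 0 = 0 := by linarith
        have : ‖ξ‖ = 0 := by
          rw [EuclideanSpace.norm_eq, Fin.sum_univ_two, z0, z1]; simp
        linarith
    have c0 := (PiLp.norm_apply_le (‖ξ‖ • η - ‖η‖ • ξ) 0).trans h9
    have c1 := (PiLp.norm_apply_le (‖ξ‖ • η - ‖η‖ • ξ) 1).trans h9
    simp only [PiLp.sub_apply, PiLp.smul_apply, smul_eq_mul, Real.norm_eq_abs] at c0 c1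
    refine ⟨⟨by linarith, ((le_abs_self _).trans (PiLp.norm_apply_le η 1)).trans h6⟩, ?_⟩
    set δ : ℝ := (2 : ℝ) ^ (-m + 5) with hδ
    have hδ0 : 0 < δ := by positivity
    -- This combination of the two coordinates of `‖ξ‖η - ‖η‖ξ` cancels the terms with `‖η‖`.
    have e : η 0 - ξ 0 / ξ 1 * η 1 = (ξ 1 * (‖ξ‖ * η 0 - ‖η‖ * ξ 0) -
        ξ 0 * (‖ξ‖ * η 1 - ‖η‖ * ξ 1)) / (‖ξ‖ * ξ 1) := by
      field_simp; ring
    rw [e, abs_div, abs_of_pos (by positivity : 0 < ‖ξ‖ * ξ 1), div_le_iff₀ (by positivity)]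
    have hξ0 : 0 ≤ ξ 0 := by linarith
    have hξ01 : ξ 0 ≤ ξ 1 := by linarith
    have step : |ξ 1 * (‖ξ‖ * η 0 - ‖η‖ * ξ 0) - ξ 0 * (‖ξ‖ * η 1 - ‖η‖ * ξ 1)| ≤
        ξ 1 * (δ * ‖η‖ * ‖ξ‖) + ξ 1 * (δ * ‖η‖ * ‖ξ‖) := by
      refine (abs_sub _ _).trans ?_
      rw [abs_mul, abs_mul, abs_of_pos hξ1, abs_of_nonneg hξ0]
      exact add_le_add (mul_le_mul_of_nonneg_left c0 hξ1.le)
        (mul_le_mul hξ01 c1 (abs_nonneg _) hξ1.le)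
    refine step.trans ?_
    have p : (2 : ℝ) ^ (j - m + 7) = 2 * δ * (2 : ℝ) ^ (j + 1) := by
      rw [hδ, show j - m + 7 = 1 + (-m + 5) + (j + 1) by ring, Real.rpow_add (by norm_num),
        Real.rpow_add (by norm_num), Real.rpow_one]
    rw [p]
    have := mul_le_mul_of_nonneg_left h6 (by positivity : 0 ≤ 2 * δ * (‖ξ‖ * ξ 1))
    linarith
  refine (measure_mono hsub).trans ?_
  rw [volume_strip, ← ENNReal.ofReal_mul (by positivity)]
  refine ENNReal.ofReal_le_ofReal (le_of_eq ?_)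
  rw [show 2 * j - m + 9 = 1 + (j - m + 7) + (j + 1) by ring, Real.rpow_add two_pos _ (j + 1),
    Real.rpow_add two_pos 1, Real.rpow_one]

/-! ### Smoothness and derivative of the oscillating factor -/

lemma hasFDerivAt_norm_of_ne_zero {E : Type*} [NormedAddCommGroup E] [InnerProductSpace ℝ E]
    {x : E} (hx : x ≠ 0) : HasFDerivAt (fun y : E => ‖y‖) (‖x‖⁻¹ • innerSL ℝ x) x := by
  have h := (hasStrictFDerivAt_norm_sq x).hasFDerivAt.sqrt (pow_ne_zero 2 (norm_ne_zero_iff.2 hx))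
  have e : (fun y : E => √(‖y‖ ^ 2)) = fun y => ‖y‖ := by
    funext y; exact Real.sqrt_sq (norm_nonneg y)
  rw [e, Real.sqrt_sq (norm_nonneg x)] at h
  convert h using 1
  ext v
  simp
  field_simp

/-- The oscillating factor. -/
def osc (τ : ℝ) (ξ η : Plane) : ℂ := Complex.exp (Complex.I * ((τ * (‖ξ - η‖ + ‖η‖) : ℝ) : ℂ))

lemma norm_osc (τ : ℝ) (ξ η : Plane) : ‖osc τ ξ η‖ = 1 := by
  rw [osc, mul_comm, Complex.norm_exp_ofReal_mul_I]

lemma contDiffAt_osc_comp {E : Type*} [NormedAddCommGroup E] [NormedSpace ℝ E] (τ : ℝ)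
    {u v : E → Plane} {x : E} (hu : ContDiff ℝ ∞ u) (hv : ContDiff ℝ ∞ v)
    (h1 : v x ≠ 0) (h2 : u x - v x ≠ 0) : ContDiffAt ℝ ∞ (fun x => osc τ (u x) (v x)) x := by
  have a1 : ContDiffAt ℝ ∞ (fun x => ‖v x‖) x := hv.contDiffAt.norm ℝ h1
  have a2 : ContDiffAt ℝ ∞ (fun x => ‖u x - v x‖) x := (hu.sub hv).contDiffAt.norm ℝ h2
  have a3 : ContDiffAt ℝ ∞ (fun x => τ * (‖u x - v x‖ + ‖v x‖)) x :=
    contDiffAt_const.mul (a2.add a1)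
  exact ((contDiffAt_const (c := Complex.I)).mul
    (Complex.ofRealCLM.contDiff.contDiffAt.comp x a3)).cexp

/-- The phase is singular only where one of the two norms vanishes, and `f` is zero in a
neighbourhood of such points. -/
lemma contDiff_osc_mul {E : Type*} [NormedAddCommGroup E] [NormedSpace ℝ E] (τ : ℝ)
    {u v : E → Plane} {f : E → ℂ} (hu : ContDiff ℝ ∞ u) (hv : ContDiff ℝ ∞ v)
    (hf : ContDiff ℝ ∞ f) {ε : ℝ} (hε : 0 < ε)
    (h0 : ∀ x, ‖v x‖ < ε ∨ ‖u x - v x‖ < ε → f x = 0) :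
    ContDiff ℝ ∞ fun x => osc τ (u x) (v x) * f x := by
  refine contDiff_iff_contDiffAt.2 fun x => ?_
  by_cases hx : v x ≠ 0 ∧ u x - v x ≠ 0
  · exact (contDiffAt_osc_comp τ hu hv hx.1 hx.2).mul hf.contDiffAt
  · have hev : ∀ᶠ y in 𝓝 x, ‖v y‖ < ε ∨ ‖u y - v y‖ < ε := by
      rw [not_and_or, not_not, not_not] at hx
      rcases hx with h | h
      · have : Tendsto (fun y => ‖v y‖) (𝓝 x) (𝓝 0) := by
          have := hv.continuous.norm.tendsto x
          rwa [h, norm_zero] at this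
        filter_upwards [this.eventually_lt_const hε] with y hy using Or.inl hy
      · have : Tendsto (fun y => ‖u y - v y‖) (𝓝 x) (𝓝 0) := by
          have := (hu.sub hv).continuous.norm.tendsto x
          rwa [h, norm_zero] at this
        filter_upwards [this.eventually_lt_const hε] with y hy using Or.inr hy
    refine (contDiffAt_const (c := (0 : ℂ))).congr_of_eventuallyEq ?_
    filter_upwards [hev] with y hy
    rw [h0 y hy, mul_zero]

lemma hasFDerivAt_osc (τ : ℝ) {ξ η : Plane} (h1 : η ≠ 0) (h2 : ξ - η ≠ 0) (v : Plane) :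
    DifferentiableAt ℝ (osc τ ξ) η ∧
      fderiv ℝ (osc τ ξ) η v = Complex.I * ((τ * inner ℝ (phaseGrad ξ η) v : ℝ) : ℂ) *
        osc τ ξ η := by
  have a1 := hasFDerivAt_norm_of_ne_zero h1
  have a2 := (hasFDerivAt_norm_of_ne_zero h2).comp η ((hasFDerivAt_id η).const_sub ξ)
  have a3 := (a2.add a1).const_mul τ
  have a4 := ((Complex.ofRealCLM.hasFDerivAt.comp η a3).const_mul Complex.I).cexp
  have a5 : HasFDerivAt (osc τ ξ) _ η := a4
  refine ⟨a5.differentiableAt, ?_⟩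
  rw [a5.fderiv]
  simp [osc, phaseGrad, inner_sub_left, inner_smul_left, -Complex.ofReal_mul]
  push_cast
  ring

/-! ### The oscillating symbol as a Schwartz function -/

section symbol

variable {j m B t : ℝ} {b : ℝ → Plane → Plane → ℂ}

lemma IsAdapted.mem_region (hb : IsAdapted j m b) (ht : 0 < t) {ξ η : Plane}
    (h : b t ξ η ≠ 0) : η ∈ symbolRegion j m ξ := by
  by_contra hn
  exact h (hb.eq_zero_unless t ht ξ η fun h' => hn (mem_symbolRegion h'.1 h'.2.1 h'.2.2))

lemma IsAdapted.eq_zero_of_small (hb : IsAdapted j m b) (ht : 0 < t) {ξ η : Plane}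
    (h : ‖η‖ < (2 : ℝ) ^ (j - 1) ∨ ‖ξ - η‖ < (2 : ℝ) ^ (j - 1)) : b t ξ η = 0 := by
  by_contra hn
  have := hb.mem_region ht hn
  rcases h with h | h
  · exact absurd this.2.2.1.1 (not_le.2 h)
  · exact absurd this.2.2.2.1.1 (not_le.2 h)

lemma IsAdapted.contDiff (hb : IsAdapted j m b) (ht : 0 < t) :
    ContDiff ℝ ∞ fun p : Plane × Plane => b t p.1 p.2 := by
  refine contDiff_iff_contDiffAt.2 fun p => ?_
  have h1 : ContDiffAt ℝ ∞ (fun p : ℝ × Plane × Plane => b p.1 p.2.1 p.2.2) (t, p) :=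
    hb.smooth.contDiffAt ((isOpen_Ioi.prod isOpen_univ).mem_nhds ⟨ht, mem_univ _⟩)
  exact ContDiffAt.comp p h1 (contDiff_prodMk_right t).contDiffAt

/-- The oscillating symbol. -/
def oscSymbol (τ t : ℝ) (b : ℝ → Plane → Plane → ℂ) (ξ η : Plane) : ℂ := osc τ ξ η * b t ξ η

lemma IsAdapted.contDiff_oscSymbol (hb : IsAdapted j m b) (ht : 0 < t) (τ : ℝ) :
    ContDiff ℝ ∞ fun p : Plane × Plane => oscSymbol τ t b p.1 p.2 :=
  contDiff_osc_mul τ contDiff_fst contDiff_snd (hb.contDiff ht)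
    (by positivity : (0 : ℝ) < 2 ^ (j - 1)) fun _ h => hb.eq_zero_of_small ht h

lemma IsAdapted.norm_le_of_ne_zero (hb : IsAdapted j m b) (ht : 0 < t) {ξ η : Plane}
    (h : b t ξ η ≠ 0) : ‖η‖ ≤ (2 : ℝ) ^ (j + 1) ∧ ‖ξ‖ ≤ 2 * (2 : ℝ) ^ (j + 1) := by
  have := hb.mem_region ht h
  refine ⟨this.2.2.1.2, ?_⟩
  calc ‖ξ‖ = ‖(ξ - η) + η‖ := by rw [sub_add_cancel]
    _ ≤ ‖ξ - η‖ + ‖η‖ := norm_add_le _ _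
    _ ≤ _ := by linarith [this.2.2.1.2, this.2.2.2.1.2]

lemma IsAdapted.hasCompactSupport_oscSymbol (hb : IsAdapted j m b) (ht : 0 < t) (τ : ℝ) :
    HasCompactSupport fun p : Plane × Plane => oscSymbol τ t b p.1 p.2 := by
  refine HasCompactSupport.intro (isCompact_closedBall (0 : Plane × Plane)
    (2 * (2 : ℝ) ^ (j + 1))) fun p hp => ?_
  by_contra hn
  have := hb.norm_le_of_ne_zero ht (right_ne_zero_of_mul hn)
  refine hp (mem_closedBall_zero_iff.2 (max_le this.2 (this.1.trans ?_)))
  have : (0 : ℝ) < (2 : ℝ) ^ (j + 1) := by positivity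
  linarith

lemma IsAdapted.contDiff_right (hb : IsAdapted j m b) (ht : 0 < t) (ξ : Plane) :
    ContDiff ℝ ∞ (b t ξ) :=
  (hb.contDiff ht).comp (contDiff_prodMk_right ξ)

lemma IsAdapted.hasCompactSupport_right (hb : IsAdapted j m b) (ht : 0 < t) (ξ : Plane) :
    HasCompactSupport (b t ξ) := by
  refine HasCompactSupport.intro (isCompact_closedBall (0 : Plane) ((2 : ℝ) ^ (j + 1)))
    fun η hη => ?_
  by_contra hn
  exact hη (mem_closedBall_zero_iff.2 (hb.norm_le_of_ne_zero ht hn).1)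

/-- The oscillating symbol at fixed `ξ` as a Schwartz function. -/
def IsAdapted.oscS (hb : IsAdapted j m b) (ht : 0 < t) (τ : ℝ) (ξ : Plane) : 𝓢(Plane, ℂ) :=
  (HasCompactSupport.mul_left (f := osc τ ξ) (hb.hasCompactSupport_right ht ξ)).toSchwartzMap
    (contDiff_osc_mul τ contDiff_const contDiff_id (hb.contDiff_right ht ξ)
      (by positivity : (0 : ℝ) < 2 ^ (j - 1)) fun _ h => hb.eq_zero_of_small ht h)

lemma IsAdapted.oscS_apply (hb : IsAdapted j m b) (ht : 0 < t) (τ : ℝ) (ξ η : Plane) :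
    hb.oscS ht τ ξ η = oscSymbol τ t b ξ η := rfl

lemma IsAdapted.eventually_eq_zero (hb : IsAdapted j m b) (ht : 0 < t) {ξ η : Plane}
    (h : η ∉ symbolRegion j m ξ) : b t ξ =ᶠ[𝓝 η] fun _ => 0 := by
  filter_upwards [(isClosed_symbolRegion j m ξ).isOpen_compl.mem_nhds h] with η' h'
  by_contra hn
  exact h' (hb.mem_region ht hn)

lemma IsAdapted.fderiv_eq_zero (hb : IsAdapted j m b) (ht : 0 < t) {ξ η : Plane}
    (h : η ∉ symbolRegion j m ξ) : fderiv ℝ (b t ξ) η = 0 := by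
  rw [(hb.eventually_eq_zero ht h).fderiv_eq, fderiv_fun_const]; rfl

/-- The remainder in the derivative of the oscillating symbol. -/
def IsAdapted.remS (hb : IsAdapted j m b) (ht : 0 < t) (τ : ℝ) (ξ : Plane) (v : Plane) :
    𝓢(Plane, ℂ) :=
  (HasCompactSupport.mul_left (f := osc τ ξ)
    ((hb.hasCompactSupport_right ht ξ).fderiv_apply ℝ v)).toSchwartzMap
    (contDiff_osc_mul τ contDiff_const contDiff_id
      (((hb.contDiff_right ht ξ).fderiv_right (m := ∞) (by norm_cast)).clm_apply contDiff_const)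
      (by positivity : (0 : ℝ) < 2 ^ (j - 1)) fun η h => by
        rw [hb.fderiv_eq_zero ht, zero_apply]
        intro hη
        rcases h with h | h
        · exact absurd hη.2.2.1.1 (not_le.2 h)
        · exact absurd hη.2.2.2.1.1 (not_le.2 h))

lemma IsAdapted.remS_apply (hb : IsAdapted j m b) (ht : 0 < t) (τ : ℝ) (ξ v η : Plane) :
    hb.remS ht τ ξ v η = osc τ ξ η * fderiv ℝ (b t ξ) η v := rfl

/-- This is the equation `∂a = iψa + r` required by `energy_estimate`. Inside the region it is the
product rule; outside, every term vanishes, so the values of the extension `ψ` there are irrelevant.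
-/
lemma IsAdapted.lineDeriv_oscS (hb : IsAdapted j m b) (ht : 0 < t) (τ : ℝ) (ξ η : Plane)
    (c : Fin 2) {ψ : Plane → ℝ}
    (hψ : ∀ η ∈ symbolRegion j m ξ, τ * phaseGrad ξ η c = ψ η) :
    (∂_{EuclideanSpace.single c (1 : ℝ)} (hb.oscS ht τ ξ) : 𝓢(Plane, ℂ)) η =
      Complex.I * (ψ η : ℂ) * hb.oscS ht τ ξ η +
        hb.remS ht τ ξ (EuclideanSpace.single c (1 : ℝ)) η := by
  rw [SchwartzMap.lineDerivOp_apply_eq_fderiv, hb.remS_apply]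
  change fderiv ℝ (fun η => osc τ ξ η * b t ξ η) η _ =
    Complex.I * (ψ η : ℂ) * (osc τ ξ η * b t ξ η) + _
  by_cases hη : η ∈ symbolRegion j m ξ
  · obtain ⟨h1, h2⟩ := hasFDerivAt_osc τ (norm_pos_iff.1 (norm_pos_of_mem hη))
      (norm_pos_iff.1 (norm_sub_pos_of_mem hη)) (EuclideanSpace.single c (1 : ℝ))
    have h3 : DifferentiableAt ℝ (b t ξ) η :=
      (hb.contDiff_right ht ξ).contDiffAt.differentiableAt (by simp)
    rw [fderiv_fun_mul h1 h3, add_apply, smul_apply, smul_apply, h2,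
      EuclideanSpace.inner_single_right]
    simp only [smul_eq_mul, one_mul, conj_trivial]
    rw [hψ η hη]
    ring
  · have h1 := hb.eventually_eq_zero ht hη
    have h2 : (fun η => osc τ ξ η * b t ξ η) =ᶠ[𝓝 η] fun _ => 0 := by
      filter_upwards [h1] with η' h'
      rw [h', mul_zero]
    rw [h2.fderiv_eq, h1.eq_of_nhds, hb.fderiv_eq_zero ht hη, fderiv_fun_const]
    simp

lemma SymbolBound.norm_le (h : SymbolBound j m B b) (ht : t ∈ Icc (1 : ℝ) 2) (ξ η : Plane) :
    ‖b t ξ η‖ ≤ B := by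
  simpa using h t ht ξ η 0 (by norm_num) (fun _ => 0)

lemma SymbolBound.norm_fderiv_le (h : SymbolBound j m B b) (ht : t ∈ Icc (1 : ℝ) 2)
    (ξ η : Plane) (c : Fin 2) :
    ‖fderiv ℝ (b t ξ) η (EuclideanSpace.single c (1 : ℝ))‖ ≤ B * (2 : ℝ) ^ (-(j - m)) := by
  simpa [iteratedFDeriv_one_apply] using h t ht ξ η 1 (by norm_num) (fun _ => c)

/-! ### Size of the high frequency part of the symbol -/

lemma eLpNorm_le_of_region {f : Plane → ℂ} {M : ℝ} (hM : 0 ≤ M) (ξ : Plane)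
    (hb : ∀ η, ‖f η‖ ≤ M) (h0 : ∀ η ∉ symbolRegion j m ξ, f η = 0) :
    eLpNorm f 2 volume ≤ ENNReal.ofReal (M * (2 : ℝ) ^ (j - m / 2 + 9 / 2)) := by
  rw [← ENNReal.pow_le_pow_left_iff two_ne_zero, eLpNorm_two_sq]
  calc ∫⁻ η, ‖f η‖ₑ ^ 2
      ≤ ∫⁻ η, (symbolRegion j m ξ).indicator (fun _ => ENNReal.ofReal M ^ 2) η := by
        refine lintegral_mono fun η => ?_
        by_cases hη : η ∈ symbolRegion j m ξ
        · rw [indicator_of_mem hη, ← ofReal_norm]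
          exact pow_le_pow_left' (ENNReal.ofReal_le_ofReal (hb η)) 2
        · rw [h0 η hη]; simp
    _ = ENNReal.ofReal M ^ 2 * volume (symbolRegion j m ξ) :=
        lintegral_indicator_const (isClosed_symbolRegion j m ξ).measurableSet _
    _ ≤ ENNReal.ofReal M ^ 2 * ENNReal.ofReal ((2 : ℝ) ^ (2 * j - m + 9)) :=
        mul_le_mul_right (volume_symbolRegion_le j m ξ) _
    _ = _ := by
        rw [ENNReal.ofReal_mul hM, mul_pow, ← ENNReal.ofReal_pow (Real.rpow_nonneg two_pos.le _),
          ← Real.rpow_natCast, ← Real.rpow_mul (by norm_num)]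
        congr 3
        push_cast; ring

/-- The high frequency part of the oscillating symbol is small. -/
lemma eLpNorm_highFreq_oscS_le {ℓ : ℝ} (hℓ : 0 ≤ ℓ) (hb : IsAdapted j m b)
    (hB : SymbolBound j m B b) (ht : t ∈ Icc (1 : ℝ) 2) (ht0 : 0 < t) {τ : ℝ} (hτ : |τ| ≤ 2)
    (ξ : Plane) :
    eLpNorm (highFreq ((2 : ℝ) ^ (-m + ℓ + 20)) (hb.oscS ht0 τ ξ)) 2 volume ≤
      ENNReal.ofReal ((kernelMoment.toReal + 1) * B * (2 : ℝ) ^ (3 / 2 * m - ℓ)) := by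
  have hB0 : 0 ≤ B := (norm_nonneg _).trans (hB.norm_le ht 0 0)
  set R : ℝ := (2 : ℝ) ^ (-m + ℓ + 20) with hRdef
  have hR : 0 < R := by positivity
  choose ψ hψL hψb hψe using fun c => exists_phase_extension j m ξ hτ c
  have key := energy_estimate hR (L := Real.toNNReal ((2 : ℝ) ^ (4 - j)))
    (ψ := fun c η => Complex.I * (ψ c η : ℂ)) (fun c => ?_) (fun c η => ?_) (hb.oscS ht0 τ ξ)
    (fun c => hb.remS ht0 τ ξ (EuclideanSpace.single c (1 : ℝ)))
    (fun c η => hb.lineDeriv_oscS ht0 τ ξ η c (hψe c))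
  rotate_left
  · refine LipschitzWith.of_dist_le_mul fun x y => ?_
    rw [dist_eq_norm, ← mul_sub, norm_mul, Complex.norm_I, one_mul, ← Complex.ofReal_sub,
      Complex.norm_real, ← dist_eq_norm]
    exact (hψL c).dist_le_mul x y
  · rw [norm_mul, Complex.norm_I, one_mul, Complex.norm_real, Real.norm_eq_abs]
    refine (hψb c η).trans ?_
    -- The oscillation rate `2^{-m+10}` is below `R/8 = 2^{-m+ℓ+17}`; this is where `ℓ ≥ 0` and the
    -- margin in `R` enter.
    rw [le_div_iff₀ (by norm_num), hRdef, show (8 : ℝ) = 2 ^ (3 : ℝ) by norm_num,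
      ← Real.rpow_add two_pos]
    exact Real.rpow_le_rpow_of_exponent_le (by norm_num) (by linarith)
  have ha : eLpNorm (hb.oscS ht0 τ ξ) 2 volume ≤
      ENNReal.ofReal (B * (2 : ℝ) ^ (j - m / 2 + 9 / 2)) := by
    refine eLpNorm_le_of_region (m := m) hB0 ξ (fun η => ?_) (fun η hη => ?_)
    · rw [hb.oscS_apply, oscSymbol, norm_mul, norm_osc, one_mul]
      exact hB.norm_le ht ξ η
    · rw [hb.oscS_apply, oscSymbol, (hb.eventually_eq_zero ht0 hη).eq_of_nhds, mul_zero]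
  have hr : ∀ c : Fin 2, eLpNorm (hb.remS ht0 τ ξ (EuclideanSpace.single c (1 : ℝ))) 2 volume ≤
      ENNReal.ofReal (B * (2 : ℝ) ^ (-(j - m)) * (2 : ℝ) ^ (j - m / 2 + 9 / 2)) := by
    intro c
    refine eLpNorm_le_of_region (m := m) (by positivity) ξ (fun η => ?_) (fun η hη => ?_)
    · rw [hb.remS_apply, norm_mul, norm_osc, one_mul]
      exact hB.norm_fderiv_le ht ξ η c
    · rw [hb.remS_apply, hb.fderiv_eq_zero ht0 hη, zero_apply, mul_zero]
  have key2 := key.trans (Finset.sum_le_sum fun c _ =>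
    add_le_add (mul_le_mul_right ha _) (hr c))
  set K := kernelMoment.toReal with hK
  have hKe : kernelMoment = ENNReal.ofReal K := (ENNReal.ofReal_toReal kernelMoment_ne_top).symm
  have hK0 : 0 ≤ K := ENNReal.toReal_nonneg
  have hLe : ((Real.toNNReal ((2 : ℝ) ^ (4 - j)) : ℝ≥0) : ℝ≥0∞) =
    ENNReal.ofReal ((2 : ℝ) ^ (4 - j)) := rfl
  rw [Fin.sum_const, hLe, hKe, ← ENNReal.ofReal_mul (by positivity),
    ← ENNReal.ofReal_mul (by positivity), ← ENNReal.ofReal_mul (by positivity),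
    ← ENNReal.ofReal_add (by positivity) (by positivity), ← ENNReal.ofReal_nsmul] at key2
  have hR4 : ENNReal.ofReal (R / 4) ≠ 0 := by
    rw [ne_eq, ENNReal.ofReal_eq_zero, not_le]; positivity
  rw [← ENNReal.mul_le_mul_iff_right hR4 ENNReal.ofReal_ne_top]
  refine key2.trans ?_
  rw [← ENNReal.ofReal_mul (by positivity)]
  refine ENNReal.ofReal_le_ofReal ?_
  -- The powers of `2^j` cancel in both error terms: the commutator is `O(2^{m/2-ℓ})`, the remainder
  -- `O(2^{m/2})`. Both fit under `2^{m/2+17}`, and the two coordinates double this to `2^{m/2+18}`.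
  have p1 : (2 : ℝ) ^ (4 - j) * R⁻¹ * K * (B * (2 : ℝ) ^ (j - m / 2 + 9 / 2)) =
      K * B * (2 : ℝ) ^ (m / 2 - ℓ - 23 / 2) := by
    rw [hRdef, ← Real.rpow_neg (by norm_num), show m / 2 - ℓ - 23 / 2 =
      (4 - j) + (-(-m + ℓ + 20)) + (j - m / 2 + 9 / 2) by ring, Real.rpow_add two_pos _ (j - _ + _),
      Real.rpow_add two_pos (4 - j)]
    ring
  have p2 : B * (2 : ℝ) ^ (-(j - m)) * (2 : ℝ) ^ (j - m / 2 + 9 / 2) =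
      B * (2 : ℝ) ^ (m / 2 + 9 / 2) := by
    rw [mul_assoc, ← Real.rpow_add two_pos]; congr 2; ring
  have p3 : R / 4 * ((K + 1) * B * (2 : ℝ) ^ (3 / 2 * m - ℓ)) =
      (K + 1) * B * (2 : ℝ) ^ (m / 2 + 18) := by
    rw [hRdef, show (4 : ℝ) = 2 ^ (2 : ℝ) by norm_num, ← Real.rpow_sub two_pos,
      show m / 2 + 18 = (-m + ℓ + 20 - 2) + (3 / 2 * m - ℓ) by ring,
      Real.rpow_add two_pos (-m + ℓ + 20 - 2)]
    ring
  have q1 : (2 : ℝ) ^ (m / 2 - ℓ - 23 / 2) ≤ (2 : ℝ) ^ (m / 2 + 17) :=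
    Real.rpow_le_rpow_of_exponent_le (by norm_num) (by linarith)
  have q2 : (2 : ℝ) ^ (m / 2 + 9 / 2) ≤ (2 : ℝ) ^ (m / 2 + 17) :=
    Real.rpow_le_rpow_of_exponent_le (by norm_num) (by linarith)
  have q3 : (2 : ℝ) ^ (m / 2 + 18) = 2 * (2 : ℝ) ^ (m / 2 + 17) := by
    rw [show m / 2 + 18 = 1 + (m / 2 + 17) by ring, Real.rpow_add two_pos, Real.rpow_one]
  rw [p1, p2, p3, q3, nsmul_eq_mul]
  have r1 := mul_le_mul_of_nonneg_left q1 (mul_nonneg hK0 hB0)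
  have r2 := mul_le_mul_of_nonneg_left q2 hB0
  push_cast
  nlinarith

end symbol

/-! ### Coordinates `(ξ,η)` on the Fourier side -/

/-- The linear change of variables `x ↦ (2π(x₁ + x₂), 2πx₂)`. -/
def shearLin : Plane2 ≃ₗ[ℝ] Plane × Plane where
  toFun x := ((2 * Real.pi) • (x.fst + x.snd), (2 * Real.pi) • x.snd)
  map_add' x y := by
    refine Prod.ext ?_ ?_
    · simp only [WithLp.add_fst, WithLp.add_snd, Prod.fst_add, ← smul_add]
      congr 1; abel
    · simp only [WithLp.add_snd, Prod.snd_add, ← smul_add]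
  map_smul' c x := by
    refine Prod.ext ?_ ?_
    · simp only [WithLp.smul_fst, WithLp.smul_snd, Prod.smul_fst, ← smul_add, RingHom.id_apply]
      rw [smul_comm]
    · simp only [WithLp.smul_snd, Prod.smul_snd, RingHom.id_apply]
      rw [smul_comm]
  invFun p := (2 * Real.pi)⁻¹ • WithLp.toLp 2 (p.1 - p.2, p.2)
  left_inv x := by
    have h : (2 * Real.pi) ≠ 0 := by positivity
    refine (WithLp.ofLp_injective 2) (Prod.ext ?_ ?_) <;>
      simp only [← smul_sub, add_sub_cancel_right, WithLp.ofLp_smul, Prod.smul_mk,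
        inv_smul_smul₀ h] <;> rfl
  right_inv p := by
    have h : (2 * Real.pi) ≠ 0 := by positivity
    refine Prod.ext ?_ ?_ <;>
      simp only [WithLp.smul_fst, WithLp.smul_snd, ← smul_add, WithLp.toLp_fst, WithLp.toLp_snd,
        sub_add_cancel, smul_inv_smul₀ h]

/-- The change of variables as a continuous linear equivalence. -/
def shear : Plane2 ≃L[ℝ] Plane × Plane :=
  { shearLin with
    continuous_toFun := by
      change Continuous fun x : Plane2 =>
        ((2 * Real.pi) • (x.fst + x.snd), (2 * Real.pi) • x.snd)
      fun_prop
    continuous_invFun := by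
      change Continuous fun p : Plane × Plane =>
        (2 * Real.pi)⁻¹ • (WithLp.toLp 2 (p.1 - p.2, p.2) : Plane2)
      fun_prop }

lemma shear_symm_apply (p : Plane × Plane) :
    shear.symm p = (2 * Real.pi)⁻¹ • WithLp.toLp 2 (p.1 - p.2, p.2) := rfl

instance isAddHaarMeasure_map_shear_symm :
    (Measure.map shear.symm
      ((volume : Measure Plane).prod (volume : Measure Plane))).IsAddHaarMeasure :=
  shear.symm.isAddHaarMeasure_map _

/-- The inverse Jacobian of the change of variables. -/
def shearFactor : ℝ≥0 :=
  Measure.addHaarScalarFactor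
    (Measure.map shear.symm ((volume : Measure Plane).prod (volume : Measure Plane)))
    (volume : Measure Plane2)

/-- Uniqueness of Haar measure replaces a computation of the Jacobian, whose value only affects the
absolute constant. -/
lemma map_shear_symm :
    Measure.map shear.symm ((volume : Measure Plane).prod (volume : Measure Plane)) =
      shearFactor • (volume : Measure Plane2) :=
  Measure.isAddLeftInvariant_eq_smul _ _

/-- The Fourier transform in the coordinates `(ξ,η)`. -/
def hatShear (F : Lp ℂ 2 (volume : Measure Plane2)) (p : Plane × Plane) : ℂ :=
  (𝓕 F : Lp ℂ 2 (volume : Measure Plane2)) (shear.symm p)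

lemma stronglyMeasurable_hatShear (F : Lp ℂ 2 (volume : Measure Plane2)) :
    StronglyMeasurable (hatShear F) :=
  (Lp.stronglyMeasurable _).comp_measurable shear.symm.continuous.measurable

lemma lintegral_hatShear_sq (F : Lp ℂ 2 (volume : Measure Plane2)) :
    ∫⁻ p, ‖hatShear F p‖ₑ ^ 2 ∂((volume : Measure Plane).prod (volume : Measure Plane)) =
      shearFactor * ENNReal.ofReal ‖F‖ ^ 2 := by
  have hm : Measurable fun x : Plane2 => ‖(𝓕 F : Lp ℂ 2 (volume : Measure Plane2)) x‖ₑ ^ 2 :=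
    (Lp.stronglyMeasurable _).measurable.enorm.pow_const 2
  have h := lintegral_map (μ := (volume : Measure Plane).prod (volume : Measure Plane)) hm
    shear.symm.continuous.measurable
  rw [map_shear_symm, lintegral_smul_measure] at h
  unfold hatShear
  rw [← h, ← eLpNorm_two_sq, ← Lp.enorm_def, ← ofReal_norm, Lp.norm_fourier_eq]
  rfl

lemma integral_comp_shear_symm (f : Plane2 → ℂ) (hf : AEStronglyMeasurable f volume) :
    ∫ p, f (shear.symm p) ∂((volume : Measure Plane).prod (volume : Measure Plane)) =
      (shearFactor : ℝ) • ∫ x, f x := by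
  rw [← integral_map shear.symm.continuous.measurable.aemeasurable, map_shear_symm,
    integral_smul_nnreal_measure]
  · rfl
  · rw [map_shear_symm]
    exact hf.smul_measure _

/-- For `F` merely in `L²` the transform is not an integral, so the multiplication formula is taken
from the compatibility with tempered distributions. -/
lemma integral_fourier_Lp_mul (F : Lp ℂ 2 (volume : Measure Plane2)) (g : 𝓢(Plane2, ℂ)) :
    ∫ x, g x * (𝓕 F : Lp ℂ 2 (volume : Measure Plane2)) x = ∫ x, 𝓕 g x * F x := by
  have h := DFunLike.congr_fun (Lp.fourier_toTemperedDistribution_eq F) g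
  rw [TemperedDistribution.fourier_apply, Lp.toTemperedDistribution_apply,
    Lp.toTemperedDistribution_apply] at h
  exact h.symm

lemma fourier_compSubConst (g : 𝓢(Plane2, ℂ)) (a y : Plane2) :
    𝓕 (g.compSubConstCLM ℂ a) y = Real.fourierChar (-inner ℝ a y) • 𝓕 g y := by
  rw [SchwartzMap.fourier_coe, SchwartzMap.fourier_coe]
  have h := congrFun (VectorFourier.fourierIntegral_comp_add_right Real.fourierChar volume
    (innerₗ Plane2) g (-a)) y
  rw [map_neg, LinearMap.neg_apply, innerₗ_apply_apply] at h
  have e : (g.compSubConstCLM ℂ a : Plane2 → ℂ) = g ∘ fun v => v + -a := by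
    funext v
    rw [SchwartzMap.compSubConstCLM_apply, Function.comp_apply, sub_eq_add_neg]
  rw [e]
  exact h

/-! ### Off-diagonal support annihilates low frequencies -/

/-- The character produced by the translation of `η` by `R⁻¹ s`. -/
def charShear (R : ℝ) (s : Plane) (y : Plane2) : ℂ :=
  (Real.fourierChar (-inner ℝ (shear.symm ((0 : Plane), R⁻¹ • s)) y) : Circle)

lemma norm_charShear (R : ℝ) (s : Plane) (y : Plane2) : ‖charShear R s y‖ = 1 :=
  Circle.norm_coe _

lemma continuous_charShear (R : ℝ) : Continuous fun p : Plane × Plane2 => charShear R p.1 p.2 := by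
  have : Continuous fun p : Plane × Plane2 => shear.symm ((0 : Plane), R⁻¹ • p.1) :=
    shear.symm.continuous.comp (by fun_prop)
  exact continuous_subtype_val.comp (Real.continuous_fourierChar.comp (by fun_prop))

/-- The kernel average of characters vanishes off the diagonal. -/
lemma integral_kernel_char {R : ℝ} (hR : 0 < R) {y : Plane2} (hy : R ≤ ‖y.fst - y.snd‖) :
    ∫ s, kernel s * charShear R s y = 0 := by
  have h := fourier_kernel ((2 * Real.pi * R)⁻¹ • (y.snd - y.fst))
  have hpi := Real.pi_pos
  -- The average is the bump at `(z-y)/(2πR)`, of norm at least `(2π)⁻¹`, the outer radius. The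
  -- radii of `bump` are chosen to match this normalization.
  rw [bump.zero_of_le_dist, Complex.ofReal_zero, Real.fourier_eq] at h
  · rw [← h]
    refine integral_congr_ae (Eventually.of_forall fun s => ?_)
    simp only
    rw [mul_comm, Circle.smul_def, smul_eq_mul, charShear]
    congr 4
    rw [shear_symm_apply, inner_smul_left, WithLp.prod_inner_apply, inner_smul_right,
      inner_sub_right]
    simp only [zero_sub, inner_neg_left, inner_smul_left, conj_trivial]
    change (2 * Real.pi)⁻¹ * (-(R⁻¹ * inner ℝ s y.fst) + R⁻¹ * inner ℝ s y.snd) = _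
    field_simp
    ring
  · rw [dist_zero_right, norm_smul, norm_sub_rev, norm_inv, Real.norm_of_nonneg (by positivity)]
    change (2 * Real.pi)⁻¹ ≤ _
    rw [mul_inv _ R, mul_assoc]
    refine le_mul_of_one_le_right (inv_nonneg.2 (by positivity : (0 : ℝ) ≤ 2 * Real.pi)) ?_
    rwa [le_inv_mul_iff₀ hR, mul_one]

/-- Off-diagonal support annihilates low frequencies: the tested form. -/
lemma integral_kernel_mul_integral_hatShear {R : ℝ} (hR : 0 < R)
    (F : Lp ℂ 2 (volume : Measure Plane2))
    (hF : ∀ᵐ p : Plane2, F p ≠ 0 → R ≤ ‖p.fst - p.snd‖) (A : 𝓢(Plane × Plane, ℂ)) :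
    ∫ s, kernel s * ∫ p : Plane × Plane, A (p - ((0 : Plane), R⁻¹ • s)) * hatShear F p
      ∂((volume : Measure Plane).prod (volume : Measure Plane)) = 0 := by
  set A3 : 𝓢(Plane2, ℂ) := SchwartzMap.compCLMOfContinuousLinearEquiv ℂ shear A with hA3
  have h1 : ∀ s : Plane, ∫ p : Plane × Plane, A (p - ((0 : Plane), R⁻¹ • s)) * hatShear F p
      ∂((volume : Measure Plane).prod (volume : Measure Plane)) =
      (shearFactor : ℝ) • ∫ y, charShear R s y *
        (𝓕 A3 y * F y) := by
    intro s
    set a := shear.symm ((0 : Plane), R⁻¹ • s) with ha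
    -- In the original coordinates the shift of `η` is a translation, which the Fourier transform
    -- turns into the character `charShear`.
    have e1 : ∀ p, A (p - ((0 : Plane), R⁻¹ • s)) * hatShear F p =
        (fun x => A3.compSubConstCLM ℂ a x * (𝓕 F : Lp ℂ 2 (volume : Measure Plane2)) x)
          (shear.symm p) := by
      intro p
      simp only [SchwartzMap.compSubConstCLM_apply, hA3,
        SchwartzMap.compCLMOfContinuousLinearEquiv_apply, Function.comp_apply, ha, map_sub,
        ContinuousLinearEquiv.apply_symm_apply, hatShear]
    rw [integral_congr_ae (Eventually.of_forall e1), integral_comp_shear_symm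
      (fun x => A3.compSubConstCLM ℂ a x * (𝓕 F : Lp ℂ 2 (volume : Measure Plane2)) x),
      integral_fourier_Lp_mul]
    · congr 2; ext y
      rw [fourier_compSubConst, Circle.smul_def, smul_eq_mul, mul_assoc, charShear]
    · exact (SchwartzMap.continuous _).aestronglyMeasurable.mul
        (Lp.stronglyMeasurable _).aestronglyMeasurable
  simp_rw [h1]
  have hint : Integrable (fun y => 𝓕 A3 y * F y) := by
    have m1 : MemLp (𝓕 A3 : 𝓢(Plane2, ℂ)) 2 volume := (𝓕 A3).memLp 2 volume
    exact m1.integrable_mul (Lp.memLp F)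
  have hk : Integrable (kernel : Plane → ℂ) := kernel.integrable (μ := volume)
  have hprod : Integrable (Function.uncurry fun (s : Plane) (y : Plane2) =>
      kernel s * (charShear R s y *
        (𝓕 A3 y * F y))) (volume.prod volume) := by
    have h0 := (hk.mul_prod hint)
    refine (h0.bdd_mul (c := 1) (continuous_charShear R).aestronglyMeasurable
      (Eventually.of_forall fun p => (norm_charShear R p.1 p.2).le)).congr (Eventually.of_forall fun p => ?_)
    simp only [Function.uncurry]
    ring
  have h2 : ∀ s : Plane, kernel s * ((shearFactor : ℝ) •
      ∫ y, charShear R s y * (𝓕 A3 y * F y)) =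
      (shearFactor : ℝ) • ∫ y, kernel s *
        (charShear R s y * (𝓕 A3 y * F y)) := by
    intro s
    rw [integral_const_mul, mul_smul_comm]
  simp_rw [h2]
  rw [integral_smul, integral_integral_swap hprod]
  have h3 : ∀ᵐ y : Plane2, ∫ s, kernel s *
      (charShear R s y * (𝓕 A3 y * F y)) = 0 := by
    filter_upwards [hF] with y hy
    by_cases h : F y = 0
    · simp [h]
    · simp_rw [← mul_assoc]
      rw [integral_mul_const, integral_mul_const, integral_kernel_char hR (hy h), zero_mul,
        zero_mul]
  rw [integral_congr_ae h3, integral_zero, smul_zero]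

/-- The integrand of the low frequency average of a symbol, tested against `hatShear F`. -/
def averageIntegrand (R : ℝ) (A : Plane × Plane → ℂ) (F : Lp ℂ 2 (volume : Measure Plane2))
    (q : (Plane × Plane) × Plane) : ℂ :=
  kernel q.2 * (A (q.1 - ((0 : Plane), R⁻¹ • q.2)) * hatShear F q.1)

lemma lintegral_hatShear_sq_ne_top (F : Lp ℂ 2 (volume : Measure Plane2)) :
    ∫⁻ p, ‖hatShear F p‖ₑ ^ 2 ∂((volume : Measure Plane).prod (volume : Measure Plane)) ≠ ⊤ := by
  rw [lintegral_hatShear_sq]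
  exact ENNReal.mul_ne_top ENNReal.coe_ne_top (ENNReal.pow_ne_top ENNReal.ofReal_ne_top)

lemma mul_le_sq_add_sq (x y : ℝ≥0∞) : x * y ≤ x ^ 2 + y ^ 2 := by
  rcases le_total x y with h | h
  · calc x * y ≤ y * y := mul_le_mul_left h _
      _ ≤ _ := by rw [← sq]; exact le_add_self
  · calc x * y ≤ x * x := mul_le_mul_right h _
      _ ≤ _ := by rw [← sq]; exact le_self_add

lemma integrable_averageIntegrand (R : ℝ) (A : 𝓢(Plane × Plane, ℂ))
    (F : Lp ℂ 2 (volume : Measure Plane2)) :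
    Integrable (averageIntegrand R A F)
      (((volume : Measure Plane).prod (volume : Measure Plane)).prod volume) := by
  set μ := (volume : Measure Plane).prod (volume : Measure Plane) with hμ
  have : μ.IsAddHaarMeasure :=
    inferInstanceAs ((volume : Measure Plane).prod (volume : Measure Plane)).IsAddHaarMeasure
  have hm : StronglyMeasurable (averageIntegrand R A F) := by
    refine (kernel.continuous.comp continuous_snd).stronglyMeasurable.mul
      (StronglyMeasurable.mul ?_ ((stronglyMeasurable_hatShear F).comp_measurable measurable_fst))
    exact (A.continuous.comp (by fun_prop)).stronglyMeasurable
  refine ⟨hm.aestronglyMeasurable, ?_⟩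
  rw [hasFiniteIntegral_iff_enorm, lintegral_prod_symm' _ hm.measurable.enorm]
  have hA : ∫⁻ p, ‖A p‖ₑ ^ 2 ∂μ ≠ ⊤ := by
    rw [← eLpNorm_two_sq]
    have h : MemLp (A : Plane × Plane → ℂ) 2 μ := A.memLp 2 μ
    exact ENNReal.pow_ne_top h.2.ne
  -- Only finiteness is needed, so the crude bound `xy ≤ x² + y²` suffices in place of
  -- Cauchy–Schwarz.
  have hbound : ∀ s : Plane, ∫⁻ p, ‖averageIntegrand R A F (p, s)‖ₑ ∂μ ≤
      ‖kernel s‖ₑ * (∫⁻ p, ‖A p‖ₑ ^ 2 ∂μ + ∫⁻ p, ‖hatShear F p‖ₑ ^ 2 ∂μ) := by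
    intro s
    have hm1 : Measurable fun p : Plane × Plane => ‖A (p - ((0 : Plane), R⁻¹ • s))‖ₑ ^ 2 :=
      ((A.continuous.comp (by fun_prop)).measurable.enorm).pow_const 2
    calc ∫⁻ p, ‖averageIntegrand R A F (p, s)‖ₑ ∂μ
        ≤ ∫⁻ p, ‖kernel s‖ₑ * (‖A (p - ((0 : Plane), R⁻¹ • s))‖ₑ ^ 2 +
            ‖hatShear F p‖ₑ ^ 2) ∂μ := by
          refine lintegral_mono fun p => ?_
          rw [averageIntegrand, enorm_mul, enorm_mul]
          exact mul_le_mul_right (mul_le_sq_add_sq _ _) _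
      _ = _ := by
          have hm2 : Measurable fun p : Plane × Plane => ‖hatShear F p‖ₑ ^ 2 :=
            (stronglyMeasurable_hatShear F).measurable.enorm.pow_const 2
          rw [lintegral_const_mul _ (by fun_prop), lintegral_add_left hm1,
            lintegral_sub_right_eq_self (μ := μ) (fun p => ‖A p‖ₑ ^ 2) ((0 : Plane), R⁻¹ • s)]
  refine (lintegral_mono hbound).trans_lt ?_
  rw [lintegral_mul_const _ kernel.continuous.measurable.enorm]
  have hk : Integrable (kernel : Plane → ℂ) := kernel.integrable (μ := volume)
  exact ENNReal.mul_lt_top hk.hasFiniteIntegral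
    (ENNReal.add_lt_top.2 ⟨hA.lt_top, (lintegral_hatShear_sq_ne_top F).lt_top⟩)

/-- Off-diagonal support annihilates low frequencies, for almost every `ξ`. -/
lemma ae_integral_average_eq_zero {R : ℝ} (hR : 0 < R) (F : Lp ℂ 2 (volume : Measure Plane2))
    (hF : ∀ᵐ p : Plane2, F p ≠ 0 → R ≤ ‖p.fst - p.snd‖) {A : Plane × Plane → ℂ}
    (hA : ContDiff ℝ ∞ A) (hAc : HasCompactSupport A) :
    ∀ᵐ ξ : Plane, ∫ η, (∫ s, kernel s * A (ξ, η - R⁻¹ • s)) * hatShear F (ξ, η) = 0 := by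
  set W : Plane → ℂ := fun ξ => ∫ η, ∫ s, averageIntegrand R A F ((ξ, η), s) with hW
  have hWeq : ∀ ξ, ∫ η, (∫ s, kernel s * A (ξ, η - R⁻¹ • s)) * hatShear F (ξ, η) = W ξ := by
    intro ξ
    refine integral_congr_ae (Eventually.of_forall fun η => ?_)
    simp only [averageIntegrand]
    rw [← integral_mul_const]
    simp only [Prod.mk_sub_mk, sub_zero, mul_assoc]
  simp_rw [hWeq]
  have hint := integrable_averageIntegrand R (hAc.toSchwartzMap hA) F
  refine ae_eq_zero_of_integral_contDiff_smul_eq_zero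
    hint.integral_prod_left.integral_prod_left.locallyIntegrable fun g hg hgc => ?_
  -- The average shifts only `η`, so a test function of `ξ` can be absorbed into the symbol, which
  -- reduces the claim to the tested form.
  have hA' : ContDiff ℝ ∞ fun p : Plane × Plane => (g p.1 : ℂ) * A p :=
    (Complex.ofRealCLM.contDiff.comp (hg.comp contDiff_fst)).mul hA
  set A' : 𝓢(Plane × Plane, ℂ) :=
    (HasCompactSupport.mul_left (f := fun p : Plane × Plane => (g p.1 : ℂ)) hAc).toSchwartzMap hA'
  have hA'p : ∀ p, A' p = (g p.1 : ℂ) * A p := fun _ => rfl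
  have hint' := integrable_averageIntegrand R A' F
  calc ∫ ξ, g ξ • W ξ = ∫ ξ, ∫ η, ∫ s, averageIntegrand R A' F ((ξ, η), s) := by
        refine integral_congr_ae (Eventually.of_forall fun ξ => ?_)
        simp only [hW]
        rw [← integral_smul]
        refine integral_congr_ae (Eventually.of_forall fun η => ?_)
        simp only
        rw [← integral_smul]
        refine integral_congr_ae (Eventually.of_forall fun s => ?_)
        simp only [averageIntegrand, hA'p, Prod.mk_sub_mk, sub_zero, Complex.real_smul]
        ring
    _ = ∫ p, ∫ s, averageIntegrand R A' F (p, s)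
          ∂volume ∂((volume : Measure Plane).prod (volume : Measure Plane)) :=
        (integral_prod (fun p => ∫ s, averageIntegrand R A' F (p, s))
          hint'.integral_prod_left).symm
    _ = ∫ s, ∫ p, averageIntegrand R A' F (p, s)
          ∂((volume : Measure Plane).prod (volume : Measure Plane)) :=
        integral_integral_swap (f := fun p s => averageIntegrand R A' F (p, s)) hint'
    _ = 0 := by
        simp only [averageIntegrand, integral_const_mul]
        exact integral_kernel_mul_integral_hatShear hR F hF A'

lemma ae_memLp_hatShear (F : Lp ℂ 2 (volume : Measure Plane2)) :
    ∀ᵐ ξ : Plane, MemLp (fun η => hatShear F (ξ, η)) 2 volume := by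
  have hm : Measurable fun p => ‖hatShear F p‖ₑ ^ 2 :=
    (stronglyMeasurable_hatShear F).measurable.enorm.pow_const 2
  have h := lintegral_hatShear_sq_ne_top F
  rw [lintegral_prod _ hm.aemeasurable] at h
  filter_upwards [ae_lt_top hm.lintegral_prod_right' h] with ξ hξ
  refine ⟨((stronglyMeasurable_hatShear F).comp_measurable
    measurable_prodMk_left).aestronglyMeasurable, ?_⟩
  rw [← eLpNorm_two_sq] at hξ
  exact (ENNReal.pow_lt_top_iff.1 hξ).resolve_right two_ne_zero

/-! ### Assembling the bound -/

/-- The pointwise bound by the high frequency part of the symbol. -/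
lemma ae_enorm_integral_le {j m t R : ℝ} {b : ℝ → Plane → Plane → ℂ} (hR : 0 < R)
    (hb : IsAdapted j m b) (ht : 0 < t) (τ : ℝ) (F : Lp ℂ 2 (volume : Measure Plane2))
    (hF : ∀ᵐ p : Plane2, F p ≠ 0 → R ≤ ‖p.fst - p.snd‖) :
    ∀ᵐ ξ : Plane, Integrable (fun η => oscSymbol τ t b ξ η * hatShear F (ξ, η)) ∧
      ‖∫ η, oscSymbol τ t b ξ η * hatShear F (ξ, η)‖ₑ ≤
        eLpNorm (highFreq R (hb.oscS ht τ ξ)) 2 volume *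
          eLpNorm (fun η => hatShear F (ξ, η)) 2 volume := by
  filter_upwards [ae_memLp_hatShear F, ae_integral_average_eq_zero hR F hF
    (hb.contDiff_oscSymbol ht τ) (hb.hasCompactSupport_oscSymbol ht τ)] with ξ hH hW
  have hS : ∀ f : 𝓢(Plane, ℂ), Integrable fun η => f η * hatShear F (ξ, η) := fun f =>
    MemLp.integrable_mul (f.memLp 2 volume) hH
  have hlow : ∫ η, lowFreq R (hb.oscS ht τ ξ) η * hatShear F (ξ, η) = 0 := by
    rw [← hW]
    simp_rw [lowFreq_apply, hb.oscS_apply]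
  refine ⟨hS (hb.oscS ht τ ξ), ?_⟩
  have e : ∫ η, oscSymbol τ t b ξ η * hatShear F (ξ, η) =
      ∫ η, highFreq R (hb.oscS ht τ ξ) η * hatShear F (ξ, η) := by
    have h := integral_sub (hS (hb.oscS ht τ ξ)) (hS (lowFreq R (hb.oscS ht τ ξ)))
    rw [hlow, sub_zero] at h
    refine h.symm.trans (integral_congr_ae (Eventually.of_forall fun η => ?_))
    simp only [highFreq, sub_apply]
    ring
  rw [e]
  refine (enorm_integral_le_lintegral_enorm _).trans ?_
  rw [← eLpNorm_one_eq_lintegral_enorm]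
  exact eLpNorm_smul_le_mul_eLpNorm (p := 2) (q := 2) (r := 1)
    (φ := fun η => highFreq R (hb.oscS ht τ ξ) η) (f := fun η => hatShear F (ξ, η))
    hH.1 (highFreq R (hb.oscS ht τ ξ)).continuous.aestronglyMeasurable

lemma S_eq (σ : ℝ) (F : Lp ℂ 2 (volume : Measure Plane2)) (b : ℝ → Plane → Plane → ℂ)
    (ξ : Plane) (t : ℝ) :
    S σ F b ξ t = ∫ η, oscSymbol (σ * t) t b ξ η * hatShear F (ξ, η) := rfl

lemma measurable_S {j m t : ℝ} {b : ℝ → Plane → Plane → ℂ} (hb : IsAdapted j m b) (ht : 0 < t)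
    (σ : ℝ) (F : Lp ℂ 2 (volume : Measure Plane2)) : Measurable fun ξ => S σ F b ξ t := by
  have h : StronglyMeasurable fun p : Plane × Plane =>
      oscSymbol (σ * t) t b p.1 p.2 * hatShear F p :=
    (hb.contDiff_oscSymbol ht (σ * t)).continuous.stronglyMeasurable.mul
      (stronglyMeasurable_hatShear F)
  exact h.integral_prod_right'.measurable

/-- The absolute constant. -/
def absConst : ℝ := (kernelMoment.toReal + 1) * (√shearFactor + 1)

lemma absConst_pos : 0 < absConst :=
  mul_pos (add_pos_of_nonneg_of_pos ENNReal.toReal_nonneg one_pos) (by positivity)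

/-- The `L²` bound at a fixed time. -/
lemma lintegral_S_sq_le {j m ℓ B t σ : ℝ} {b : ℝ → Plane → Plane → ℂ} (hℓ : 0 ≤ ℓ)
    (hb : IsAdapted j m b) (hB : SymbolBound j m B b) (ht : t ∈ Icc (1 : ℝ) 2) (hσ : |σ| = 1)
    (F : Lp ℂ 2 (volume : Measure Plane2))
    (hF : ∀ᵐ p : Plane2, F p ≠ 0 → (2 : ℝ) ^ (-m + ℓ + 20) ≤ ‖p.fst - p.snd‖) :
    ∫⁻ ξ, ‖S σ F b ξ t‖ₑ ^ 2 ≤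
      ENNReal.ofReal (absConst * B * (2 : ℝ) ^ (3 / 2 * m - ℓ) * ‖F‖) ^ 2 := by
  have ht0 : 0 < t := one_pos.trans_le ht.1
  have hB0 : 0 ≤ B := (norm_nonneg _).trans (hB.norm_le ht 0 0)
  have hτ : |σ * t| ≤ 2 := by
    rw [abs_mul, hσ, one_mul, abs_of_pos ht0]; exact ht.2
  set D := (kernelMoment.toReal + 1) * B * (2 : ℝ) ^ (3 / 2 * m - ℓ) with hD
  have hD0 : 0 ≤ D := by positivity
  have hm : Measurable fun p => ‖hatShear F p‖ₑ ^ 2 :=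
    (stronglyMeasurable_hatShear F).measurable.enorm.pow_const 2
  calc ∫⁻ ξ, ‖S σ F b ξ t‖ₑ ^ 2
      ≤ ∫⁻ ξ, ENNReal.ofReal D ^ 2 * ∫⁻ η, ‖hatShear F (ξ, η)‖ₑ ^ 2 := by
        refine lintegral_mono_ae ?_
        filter_upwards [ae_enorm_integral_le (by positivity) hb ht0 (σ * t) F hF] with ξ hξ
        rw [← eLpNorm_two_sq, ← mul_pow, S_eq]
        exact pow_le_pow_left' (hξ.2.trans
          (mul_le_mul_left (eLpNorm_highFreq_oscS_le hℓ hb hB ht ht0 hτ ξ) _)) 2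
    _ = ENNReal.ofReal D ^ 2 * (shearFactor * ENNReal.ofReal ‖F‖ ^ 2) := by
        rw [lintegral_const_mul _ hm.lintegral_prod_right', ← lintegral_prod _ hm.aemeasurable,
          lintegral_hatShear_sq]
    _ ≤ ENNReal.ofReal D ^ 2 * (ENNReal.ofReal (√shearFactor + 1) ^ 2 *
          ENNReal.ofReal ‖F‖ ^ 2) := by
        refine mul_le_mul_right (mul_le_mul_left ?_ _) _
        rw [← ENNReal.ofReal_pow (by positivity), ← ENNReal.ofReal_coe_nnreal]
        refine ENNReal.ofReal_le_ofReal ?_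
        -- The `+ 1` in `√shearFactor + 1` keeps the constant positive without knowing that the
        -- factor is nonzero.
        nlinarith [Real.sq_sqrt shearFactor.coe_nonneg, Real.sqrt_nonneg (shearFactor : ℝ)]
    _ = _ := by
        rw [← mul_pow, ← mul_pow, ← ENNReal.ofReal_mul (by positivity),
          ← ENNReal.ofReal_mul hD0]
        congr 2
        rw [absConst, hD]; ring

lemma measurable_S_planeTimes {j m : ℝ} {b : ℝ → Plane → Plane → ℂ} (hb : IsAdapted j m b)
    (σ : ℝ) (F : Lp ℂ 2 (volume : Measure Plane2)) {𝓔 : Finset ℝ}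
    (h𝓔 : ∀ t ∈ 𝓔, t ∈ Icc (1 : ℝ) 2) :
    Measurable fun p : Plane × 𝓔 => S σ F b p.1 (p.2 : ℝ) :=
  measurable_from_prod_countable_left fun t =>
    measurable_S hb (one_pos.trans_le (h𝓔 t t.2).1) σ F

lemma lintegral_planeTimes {𝓔 : Finset ℝ} {f : Plane × 𝓔 → ℝ≥0∞} (hf : Measurable f) :
    ∫⁻ p, f p ∂planeTimes 𝓔 = ∑ t : 𝓔, ∫⁻ ξ, f (ξ, t) := by
  rw [planeTimes, lintegral_prod_symm' _ hf, lintegral_count, tsum_fintype]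

lemma eLpNorm_S_le {j m ℓ B σ : ℝ} {b : ℝ → Plane → Plane → ℂ} (hℓ : 0 ≤ ℓ)
    (hb : IsAdapted j m b) (hB : SymbolBound j m B b) (hσ : |σ| = 1)
    (F : Lp ℂ 2 (volume : Measure Plane2))
    (hF : ∀ᵐ p : Plane2, F p ≠ 0 → (2 : ℝ) ^ (-m + ℓ + 20) ≤ ‖p.fst - p.snd‖)
    {𝓔 : Finset ℝ} (h𝓔 : ∀ t ∈ 𝓔, t ∈ Icc (1 : ℝ) 2) :
    eLpNorm (fun p : Plane × 𝓔 => S σ F b p.1 (p.2 : ℝ)) 2 (planeTimes 𝓔) ≤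
      ENNReal.ofReal (absConst * B * (2 : ℝ) ^ (3 / 2 * m - ℓ) * (𝓔.card : ℝ) ^ (1 / 2 : ℝ) *
        ‖F‖) := by
  have hB0 : 0 ≤ B := (norm_nonneg _).trans (hB.norm_le (left_mem_Icc.2 one_le_two) 0 0)
  have hc := absConst_pos
  rw [← ENNReal.pow_le_pow_left_iff two_ne_zero, eLpNorm_two_sq,
    lintegral_planeTimes ((measurable_S_planeTimes hb σ F h𝓔).enorm.pow_const 2)]
  refine (Finset.sum_le_sum fun (t : 𝓔) _ =>
    lintegral_S_sq_le hℓ hb hB (h𝓔 t.1 t.2) hσ F hF).trans (le_of_eq ?_)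
  rw [Finset.sum_const, Finset.card_univ, Fintype.card_coe, ← ENNReal.ofReal_pow (by positivity),
    ← ENNReal.ofReal_pow (by positivity), ← ENNReal.ofReal_nsmul, nsmul_eq_mul]
  congr 1
  have h : ((𝓔.card : ℝ) ^ (1 / 2 : ℝ)) ^ 2 = 𝓔.card := by
    rw [← Real.sqrt_eq_rpow, Real.sq_sqrt (by positivity)]
  simp only [mul_pow, h]
  ring

end OffDiag

end

theorem mainTheorem8 :
    ∃ c : ℝ, 0 < c ∧
      ∀ (σ : ℝ), (σ = 1 ∨ σ = -1) →
      ∀ (j m ℓ B : ℝ), 0 ≤ m → m ≤ j / 2 → 0 ≤ ℓ →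
      ∀ (b : ℝ → OffDiag.Plane → OffDiag.Plane → ℂ),
        OffDiag.IsAdapted j m b → OffDiag.SymbolBound j m B b →
      ∀ (F : Lp ℂ 2 (volume : Measure OffDiag.Plane2)),
        (∀ᵐ p : OffDiag.Plane2, F p ≠ 0 → (2 : ℝ) ^ (-m + ℓ + 20) ≤ ‖p.fst - p.snd‖) →
      ∀ (𝓔 : Finset ℝ), (∀ t ∈ 𝓔, t ∈ Icc (1 : ℝ) 2) →
        (∀ t ∈ 𝓔, ∀ᵐ ξ : OffDiag.Plane,
          Integrable (fun η : OffDiag.Plane => OffDiag.integrandS σ F b ξ t η)) ∧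
        MemLp (fun p : OffDiag.Plane × 𝓔 => OffDiag.S σ F b p.1 (p.2 : ℝ)) 2
          (OffDiag.planeTimes 𝓔) ∧
        eLpNorm (fun p : OffDiag.Plane × 𝓔 => OffDiag.S σ F b p.1 (p.2 : ℝ)) 2
            (OffDiag.planeTimes 𝓔)
          ≤ ENNReal.ofReal
              (c * B * (2 : ℝ) ^ (3 / 2 * m - ℓ) * (𝓔.card : ℝ) ^ (1 / 2 : ℝ) * ‖F‖) := by
  refine ⟨OffDiag.absConst, OffDiag.absConst_pos, ?_⟩
  intro σ hσ j m ℓ B _ _ hℓ b hb hB F hF 𝓔 h𝓔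
  have hσ1 : |σ| = 1 := by rcases hσ with rfl | rfl <;> simp
  have hle := OffDiag.eLpNorm_S_le hℓ hb hB hσ1 F hF h𝓔
  refine ⟨fun t ht => ?_, ⟨(OffDiag.measurable_S_planeTimes hb σ F h𝓔).aestronglyMeasurable,
    hle.trans_lt ENNReal.ofReal_lt_top⟩, hle⟩
  filter_upwards [OffDiag.ae_enorm_integral_le (by positivity) hb
    (one_pos.trans_le (h𝓔 t ht).1) (σ * t) F hF] with ξ hξ using hξ.1
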